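/- **Setting (2-hop network).** A source with $M_0\ge 1$ antennas sends to a destination with $M_2\ge1$ antennas through $M_1\ge1$ single-antenna relays. The source–relay gains $h_{mk}$, the relay–destination gains $g_{ki}$, the relay noises $n_k\in\mathbb C^{M_0}$ and the destination noise $Z\in\mathbb C^{M_1\times M_2}$ are independent with i.i.d. $\mathcal{CN}(0,1)$ entries. Relay $k$ knows $h_k=(h_{1k},\dots,h_{M_0k})^T$; the destination knows all $h_{mk}$ and $g_{ki}$. Write $\bar x$ for the entrywise conjugate and $^*$ for the conjugate transpose. **COSTBC.** An $L$-symbol COSTBC consists of a finite constellation $\mathcal S\subset\mathbb C$ (symbol vectors $s\in\mathcal S^L$ are equally likely), a design $S_0(s)=\sum_{l}(s_lC_l+\bar s_lC'_l)\in\mathbb C^{M_0\times M_0}$ and matrices $A_k,B_k\in\mathbb C^{M_1\times L}$ $(1\le k\le M_1)$, such that - $S_0(s)S_0(s)^*=\|s\|^2 I_{M_0}$ for all $s\in\mathbb C^L$, and $\mathbb E\,\mathrm{tr}(S_0^*S_0)=M_0$ over the codewords; - $A_k^*B_k=-B_k^*A_k$ for all $k$, and for all $k,l$ the $l$-th columns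 of $A_k$ and $B_k$ have squared norms that add up to $1$; - $S_1(s)=[A_1s+B_1\bar s\ \cdots\ A_{M_1}s+B_{M_1}\bar s]$ satisfies $S_1(s)S_1(s)^*=\|s\|^2I_{M_1}$ for all $s\in\mathbb C^L$. Relay $k$ receives $r_k=\sqrt{E_0}\,S_0(s)h_k+n_k$. It forms $\hat r_k\in\mathbb C^L$ with entries $\hat r_{k,l}=\|h_k\|^{-1}\big((C_lh_k)^*r_k+(C'_lh_k)^T\bar r_k\big)$ (so that $\hat r_k=\sqrt{E_0}\,\|h_k\|s+\text{noise}$) and sends, during $M_1$ time instants, $$t_k=\sqrt{\frac{E_1M_1}{\mathbb E\|\hat r_k\|^2}}\,\big(A_k\hat r_k+B_k\overline{\hat r_k}\big).$$ The destination receives $Y=[t_1\cdots t_{M_1}]\,G+Z$ with $G=(g_{ki})$. For $s\ne s'$ in $\mathcal S^L$ the pairwise error probability $P_e(s\to s')$ is the probability, when $s$ is sent, that the conditional density of $Y$ given the channels is at least as large for $s'$ as for $s$ (maximum-likelihood detection). **Theorem.** For every COSTBC in a 2-hop network, use the power split $E_0=\frac E2$, $E_1=\frac{E}{2M_1}$.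 Then for every $E>0$ the source spends average power $\frac E2$ and each relay $\frac{E}{2M_1}$ per time instant, so that the total transmit power is $E$. Moreover the diversity gain is $\min\{M_0M_1,\,M_1M_2\}$: for all $s\neq s'$ in $\mathcal S^L$, $$-\lim_{E\to\infty}\frac{\log P_e(s\to s')}{\log E}=\min\{M_0M_1,\;M_1M_2\}.$$ -/

import Mathlib

open MeasureTheory ProbabilityTheory Filter Topology
open scoped BigOperators ComplexConjugate

noncomputable section

/-- The circularly symmetric complex Gaussian law `CN(0,1)`: independent real and imaginary parts,
each of mean `0` and variance `1/2`. -/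
def complexGaussian : Measure ℂ :=
  ((gaussianReal 0 (1 / 2)).prod (gaussianReal 0 (1 / 2))).map (fun p : ℝ × ℝ => (⟨p.1, p.2⟩ : ℂ))

/-- Arrays of complex numbers (channel gains, noise samples), with the product σ-algebra. -/
abbrev CArray (m n : ℕ) : Type := Fin m → Fin n → ℂ

/-- The law of an `m × n` array of i.i.d. `CN(0,1)` entries. -/
def gaussianArray (m n : ℕ) : Measure (CArray m n) :=
  Measure.pi fun _ => Measure.pi fun _ => complexGaussian

/-- A `T × N` space-time block design in `L` complex variables `s₁, …, s_L`: a matrix whose entries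
are complex linear combinations of the variables (coefficient matrices `coef`) and of their
conjugates (coefficient matrices `conjCoef`). -/
structure STDesign (L T N : ℕ) where
  coef : Fin L → Matrix (Fin T) (Fin N) ℂ
  conjCoef : Fin L → Matrix (Fin T) (Fin N) ℂ

namespace STDesign

variable {L T N : ℕ}

/-- The matrix obtained by giving the variables the values `s`. -/
def eval (D : STDesign L T N) (s : Fin L → ℂ) : Matrix (Fin T) (Fin N) ℂ :=
  ∑ l, (s l • D.coef l + conj (s l) • D.conjCoef l)

/-- A square design is orthogonal if `D D^* = (|s₁|² + ⋯ + |s_L|²) I` identically in `s`. -/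
def IsOrthogonal {K : ℕ} (D : STDesign L K K) : Prop :=
  ∀ s : Fin L → ℂ,
    D.eval s * (D.eval s).conjTranspose = ((∑ l, ‖s l‖ ^ 2 : ℝ) : ℂ) • (1 : Matrix (Fin K) (Fin K) ℂ)

/-- Coherent combining of `r = D(s) h + noise` with `h` known, separating the symbols: the `l`-th
output is `(C_l h)^* r + (C'_l h)^T conj r`, where `C_l`, `C'_l` are the coefficient matrices of
`s_l` and `conj s_l`. -/
def combine (D : STDesign L T N) (h : Fin N → ℂ) (r : Fin T → ℂ) (l : Fin L) : ℂ :=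
  ∑ t, (conj ((D.coef l).mulVec h t) * r t + (D.conjCoef l).mulVec h t * conj (r t))

end STDesign

/-- The design whose `k`-th column is `A_k s + B_k conj s`. -/
def relayDesign {L M : ℕ} (A B : Fin M → Matrix (Fin M) (Fin L) ℂ) : STDesign L M M where
  coef l := Matrix.of fun t k => A k t l
  conjCoef l := Matrix.of fun t k => B k t l

/-- All vectors of `L` constituent symbols with values in a finite constellation. -/
def symbolVectors (L : ℕ) (S : Finset ℂ) : Finset (Fin L → ℂ) := Fintype.piFinset fun _ => S

/-- Average of `f` over equally likely symbol vectors. -/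
def symbolAverage (L : ℕ) (S : Finset ℂ) (f : (Fin L → ℂ) → ℝ) : ℝ :=
  (∑ s ∈ symbolVectors L S, f s) / ((symbolVectors L S).card : ℝ)

/-- A cascaded orthogonal space-time block code for a two-hop network with `M₀` source antennas and
`M₁` single-antenna relays, carrying `L` constituent symbols per block. -/
structure COSTBC (M₀ M₁ L : ℕ) where
  /-- the finite signal constellation -/
  constellation : Finset ℂ
  /-- the design used by the source -/
  S₀ : STDesign L M₀ M₀
  /-- relay `k` sends a multiple of `A k * r + B k * conj r` -/
  A : Fin M₁ → Matrix (Fin M₁) (Fin L) ℂ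
  B : Fin M₁ → Matrix (Fin M₁) (Fin L) ℂ
  source_orthogonal : S₀.IsOrthogonal
  /-- `𝔼 tr (S₀^* S₀) = M₀` -/
  source_normalized : symbolAverage L constellation
    (fun s => ((S₀.eval s).conjTranspose * S₀.eval s).trace.re) = M₀
  relay_skew : ∀ k, (A k).conjTranspose * B k = -((B k).conjTranspose * A k)
  relay_column : ∀ k l, ∑ t, (‖A k t l‖ ^ 2 + ‖B k t l‖ ^ 2) = 1
  relay_orthogonal : (relayDesign A B).IsOrthogonal

namespace COSTBC

variable {M₀ M₁ L : ℕ} (c : COSTBC M₀ M₁ L)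

/-- The symbol vectors indexing the codewords. -/
def codebook : Finset (Fin L → ℂ) := symbolVectors L c.constellation

/-- The signal `√E₀ S₀ h_k + n_k` received by relay `k` during the `M₀` instants of the first hop.
`h m k` is the gain from source antenna `m` to relay `k`, and `n t k` the noise of relay `k` at
instant `t`. -/
def relayRx (E₀ : ℝ) (s : Fin L → ℂ) (h n : CArray M₀ M₁) (k : Fin M₁) (t : Fin M₀) : ℂ :=
  (√E₀ : ℂ) * (c.S₀.eval s).mulVec (fun m => h m k) t + n t k

/-- The processed signal of relay `k`: the received block is combined with the help of `h_k`, then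
divided by `(∑ m, |h m k|²)^{1/2}`. For an orthogonal `S₀` the result is
`√E₀ (∑ m, |h m k|²)^{1/2} s` plus noise. -/
def relaySymbols (E₀ : ℝ) (s : Fin L → ℂ) (h n : CArray M₀ M₁) (k : Fin M₁) (l : Fin L) : ℂ :=
  c.S₀.combine (fun m => h m k) (c.relayRx E₀ s h n k) l / (√(∑ m, ‖h m k‖ ^ 2) : ℂ)

/-- The mean energy `𝔼 ‖r‖²` of the processed block `r` of relay `k`, over symbols, fading and
noise. -/
def relayEnergy (E₀ : ℝ) (k : Fin M₁) : ℝ :=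
  symbolAverage L c.constellation fun s =>
    ∫ ω : CArray M₀ M₁ × CArray M₀ M₁, ∑ l, ‖c.relaySymbols E₀ s ω.1 ω.2 k l‖ ^ 2
      ∂((gaussianArray M₀ M₁).prod (gaussianArray M₀ M₁))

/-- The block sent by relay `k` during the `M₁` instants of the second hop, scaled so that its mean
energy is `E₁ M₁`. -/
def relayTx (E₀ E₁ : ℝ) (s : Fin L → ℂ) (h n : CArray M₀ M₁) (k t : Fin M₁) : ℂ :=
  (√(E₁ * M₁ / c.relayEnergy E₀ k) : ℂ) *
    ((c.A k).mulVec (c.relaySymbols E₀ s h n k) t +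
      (c.B k).mulVec (fun l => conj (c.relaySymbols E₀ s h n k l)) t)

/-- Average power per time instant sent by the source. -/
def sourcePower (E₀ : ℝ) : ℝ :=
  symbolAverage L c.constellation fun s =>
    (∑ t, ∑ m, ‖(√E₀ : ℂ) * c.S₀.eval s t m‖ ^ 2) / M₀

/-- Average power per time instant sent by relay `k`. -/
def relayPower (E₀ E₁ : ℝ) (k : Fin M₁) : ℝ :=
  symbolAverage L c.constellation fun s =>
    ∫ ω : CArray M₀ M₁ × CArray M₀ M₁, (∑ t, ‖c.relayTx E₀ E₁ s ω.1 ω.2 k t‖ ^ 2) / M₁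
      ∂((gaussianArray M₀ M₁).prod (gaussianArray M₀ M₁))

variable {M₂ : ℕ}

/-- The superposition at the destination of the relay signals, before the destination's own noise:
entry `(t, i)` is `∑ k, t_k(t) g_{ki}`, where `g k i` is the gain from relay `k` to antenna `i`. -/
def relayedSignal (E₀ E₁ : ℝ) (s : Fin L → ℂ) (h : CArray M₀ M₁) (g : CArray M₁ M₂)
    (n : CArray M₀ M₁) : CArray M₁ M₂ :=
  fun t i => ∑ k, c.relayTx E₀ E₁ s h n k t * g k i

/-- The array `Y` received at the destination; `z` is the noise of the destination. -/
def received (E₀ E₁ : ℝ) (s : Fin L → ℂ) (h : CArray M₀ M₁) (g : CArray M₁ M₂)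
    (n : CArray M₀ M₁) (z : CArray M₁ M₂) : CArray M₁ M₂ :=
  fun t i => c.relayedSignal E₀ E₁ s h g n t i + z t i

/-- The likelihood: the conditional probability density (with respect to Lebesgue measure) at `y` of
the received array, given the channels `h`, `g` and the symbol vector `s`. Given also the relay noise
`n`, the received array is the relayed signal plus i.i.d. `CN(0,1)` noise, whose density is
`w ↦ π^{-M₁M₂} exp(-‖w‖²)`; the relay noise, unknown to the destination, is averaged out. -/
def likelihood (E₀ E₁ : ℝ) (s : Fin L → ℂ) (h : CArray M₀ M₁) (g : CArray M₁ M₂)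
    (y : CArray M₁ M₂) : ℝ :=
  ∫ n, (Real.pi ^ (M₁ * M₂))⁻¹ *
    Real.exp (-∑ t, ∑ i, ‖y t i - c.relayedSignal E₀ E₁ s h g n t i‖ ^ 2) ∂(gaussianArray M₀ M₁)

/-- The pairwise error probability: `s` is sent, and the destination, which knows `h` and `g` and
decides by maximum likelihood, finds `s'` at least as likely as `s`. The channels and noises are
independent arrays of i.i.d. `CN(0,1)` entries. -/
def pairwiseErrorProb (M₂ : ℕ) (E₀ E₁ : ℝ) (s s' : Fin L → ℂ) : ℝ :=
  ((gaussianArray M₀ M₁).prod ((gaussianArray M₁ M₂).prod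
      ((gaussianArray M₀ M₁).prod (gaussianArray M₁ M₂)))).real
    {ω : CArray M₀ M₁ × CArray M₁ M₂ × CArray M₀ M₁ × CArray M₁ M₂ |
      c.likelihood E₀ E₁ s ω.1 ω.2.1 (c.received E₀ E₁ s ω.1 ω.2.1 ω.2.2.1 ω.2.2.2) ≤
        c.likelihood E₀ E₁ s' ω.1 ω.2.1 (c.received E₀ E₁ s ω.1 ω.2.1 ω.2.2.1 ω.2.2.2)}

end COSTBC

/-- `d = -lim_{E → ∞} log P_e(E) / log E`, the limit being required to exist. -/
def HasDiversityGain (Pe : ℝ → ℝ) (d : ℝ) : Prop :=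
  Tendsto (fun E => -(Real.log (Pe E) / Real.log E)) atTop (𝓝 d)

end

/-!
The proof reduces the error event, for given channels, to a tail event of one real Gaussian variable
and then averages the resulting exponential over the channels.

**Powers.** Orthogonality of `S₀` says that `s ↦ S₀(s) h` is `‖h‖` times a real isometry; the
combiner of a relay is its real adjoint. Hence the processed signal is `√E₀ ‖h_k‖ s` plus a noise of
energy `L`, so that `𝔼 ‖r̂_k‖² = E₀ M₀ + L` (`COSTBC.relayEnergy_eq`), and the processing
`r ↦ A_k r + B_k conj r` preserves the norm because it is a column of an orthogonal design.

**Given channels.** The destination sees `μ(s) + N n + z`, with `N` real-linear and `n`, `z` standard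
Gaussian. The likelihoods are translates of one function `q`, the density of `N n + z`. If
`δ = μ(s) - μ(s')` is written as `u + N Nᵀ u`, the translation `n ↦ n + Nᵀ u` in the integral defining
`q` (Cameron–Martin) gives `q (v + δ) = exp (-(2 ⟨u, v⟩ + Q)) q v` with `Q = |u|² + |Nᵀ u|²`
(`noiseDensity_add`); no covariance matrix has to be inverted explicitly. So an error means
`2 ξ + Q ≤ 0` for a centred Gaussian `ξ` of variance `Q / 2`, which has probability between
`exp (-Q / 2) / 4` and `exp (-Q / 4)`. Moreover `|δ|² / (1 + |N|²) ≤ Q ≤ |δ|²`, where `|δ|²` is of order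
`E ∑ k, ‖h_k‖² ‖g_k‖²` by orthogonality of the relay design, and `|N|²` is at most `∑ k, ‖g_k‖²`
(`COSTBC.conditional_error_bounds`).

**Averaging.** For the upper bound, `exp (-y) ≤ a ^ a * y ^ (-a)` for each relay dominates the
exponential by a product of functions of the single channel gains, whose means are finite when
`a < min M₀ M₂`; this gives the decay `E ^ (-a M₁)` (`COSTBC.pairwiseErrorProb_upper`). For the lower
bound the gains of one of the hops are taken of order `E ^ (-1 / 2)`, which happens with probability of
order `E ^ (-M₀ M₁)` or `E ^ (-M₁ M₂)` and keeps `Q` bounded (`COSTBC.pairwiseErrorProb_lower`). The two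
bounds pinch the exponent.
-/

noncomputable section

/-! ### The complex Gaussian law and its translates -/

/-- The real inner product `Re ∑ i, conj (x i) * y i` of two complex vectors. -/
def vecInner {ι : Type*} [Fintype ι] (x y : ι → ℂ) : ℝ := ∑ i, (conj (x i) * y i).re

/-- The real (Frobenius) inner product of two complex arrays. -/
def arrayInner {m n : ℕ} (x y : CArray m n) : ℝ := ∑ i, vecInner (x i) (y i)

lemma complexGaussian_eq_withDensity :
    complexGaussian =
      volume.withDensity (fun z : ℂ => ENNReal.ofReal (Real.pi⁻¹ * Real.exp (-‖z‖ ^ 2))) := by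
  have hv : (1 / 2 : NNReal) ≠ 0 := by norm_num
  have hmeas : Measurable (fun p : ℝ × ℝ => (⟨p.1, p.2⟩ : ℂ)) :=
    Complex.measurableEquivRealProd.symm.measurable
  have hmp : MeasurePreserving (fun p : ℝ × ℝ => (⟨p.1, p.2⟩ : ℂ)) :=
    Complex.volume_preserving_equiv_real_prod.symm
  have hpt : ∀ p : ℝ × ℝ, gaussianPDF 0 (1 / 2) p.1 * gaussianPDF 0 (1 / 2) p.2 =
      ENNReal.ofReal (Real.pi⁻¹ * Real.exp (-‖(⟨p.1, p.2⟩ : ℂ)‖ ^ 2)) := by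
    intro p
    rw [gaussianPDF, gaussianPDF, ← ENNReal.ofReal_mul (gaussianPDFReal_nonneg _ _ _)]
    congr 1
    have h2 : (((1 / 2 : NNReal) : NNReal) : ℝ) = 1 / 2 := by norm_num
    rw [gaussianPDFReal, gaussianPDFReal, h2, Complex.sq_norm, Complex.normSq_mk]
    have h3 : 2 * Real.pi * (1 / 2) = Real.pi := by ring
    rw [h3, mul_mul_mul_comm, ← Real.exp_add, ← mul_inv, Real.mul_self_sqrt Real.pi_pos.le]
    congr 2
    ring
  rw [complexGaussian, gaussianReal_of_var_ne_zero _ hv,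
    prod_withDensity (measurable_gaussianPDF _ _) (measurable_gaussianPDF _ _),
    ← Measure.volume_eq_prod]
  ext s hs
  rw [Measure.map_apply hmeas hs, withDensity_apply _ (hmeas hs), withDensity_apply _ hs,
    ← hmp.setLIntegral_comp_preimage hs (by fun_prop)]
  simp_rw [hpt]

instance : IsProbabilityMeasure complexGaussian :=
  Measure.isProbabilityMeasure_map
    (Complex.measurableEquivRealProd.symm.measurable.aemeasurable)

instance (m n : ℕ) : IsProbabilityMeasure (gaussianArray m n) := by
  unfold gaussianArray; infer_instance

lemma lintegral_pi_prod {ι : Type*} [Fintype ι] {α : ι → Type*} [∀ i, MeasurableSpace (α i)]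
    (μ : ∀ i, Measure (α i)) [∀ i, IsProbabilityMeasure (μ i)] {f : ∀ i, α i → ENNReal}
    (hf : ∀ i, Measurable (f i)) :
    ∫⁻ x, ∏ i, f i (x i) ∂(Measure.pi μ) = ∏ i, ∫⁻ x, f i x ∂(μ i) := by
  rw [lintegral_prod_eq_prod_lintegral_of_indepFun Finset.univ (fun i (x : ∀ i, α i) => f i (x i))
    (iIndepFun_pi fun i => (hf i).aemeasurable) (fun i => (hf i).comp (measurable_pi_apply i))]
  exact Finset.prod_congr rfl fun i _ =>
    (measurePreserving_eval μ i).lintegral_comp (hf i)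

lemma lintegral_gaussianArray_prod {m n : ℕ} {f : Fin m → Fin n → ℂ → ENNReal}
    (hf : ∀ i j, Measurable (f i j)) :
    ∫⁻ x, ∏ i, ∏ j, f i j (x i j) ∂(gaussianArray m n) =
      ∏ i, ∏ j, ∫⁻ z, f i j z ∂complexGaussian := by
  rw [gaussianArray, lintegral_pi_prod (fun _ : Fin m => Measure.pi fun _ : Fin n => complexGaussian)
    (f := fun i (x : Fin n → ℂ) => ∏ j, f i j (x j))]
  · exact Finset.prod_congr rfl fun i _ => lintegral_pi_prod _ (hf i)
  · exact fun i => Finset.measurable_prod _ fun j _ => (hf i j).comp (measurable_pi_apply j)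

/-- If each coordinate map sends `μ i` to a measure with density `ρ i`, then the product map sends
the product measure to the measure with the product density. -/
lemma pi_map_eq_withDensity {ι : Type*} [Fintype ι] {α : ι → Type*} [∀ i, MeasurableSpace (α i)]
    (μ : ∀ i, Measure (α i)) [∀ i, IsProbabilityMeasure (μ i)] {f : ∀ i, α i → α i}
    (hf : ∀ i, Measurable (f i)) {ρ : ∀ i, α i → ENNReal} (hρ : ∀ i, Measurable (ρ i))
    (h : ∀ i, (μ i).map (f i) = (μ i).withDensity (ρ i)) :
    (Measure.pi μ).map (fun x i => f i (x i)) =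
      (Measure.pi μ).withDensity (fun x => ∏ i, ρ i (x i)) := by
  have : ∀ i, IsProbabilityMeasure ((μ i).map (f i)) := fun i =>
    Measure.isProbabilityMeasure_map (hf i).aemeasurable
  rw [Measure.pi_map_pi fun i => (hf i).aemeasurable]
  refine Measure.pi_eq fun s hs => ?_
  rw [withDensity_apply _ (MeasurableSet.univ_pi hs),
    ← lintegral_indicator (MeasurableSet.univ_pi hs)]
  have : ∀ x : ∀ i, α i, (Set.univ.pi s).indicator (fun x => ∏ i, ρ i (x i)) x =
      ∏ i, (s i).indicator (ρ i) (x i) := by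
    intro x
    by_cases hx : x ∈ Set.univ.pi s
    · rw [Set.indicator_of_mem hx]
      exact Finset.prod_congr rfl fun i _ => (Set.indicator_of_mem (hx i trivial) _).symm
    · rw [Set.indicator_of_notMem hx]
      simp only [Set.mem_pi, Set.mem_univ, true_imp_iff, not_forall] at hx
      obtain ⟨i, hi⟩ := hx
      exact (Finset.prod_eq_zero (Finset.mem_univ i) (Set.indicator_of_notMem hi _)).symm
  simp_rw [this]
  rw [lintegral_pi_prod μ fun i => (hρ i).indicator (hs i)]
  refine Finset.prod_congr rfl fun i _ => ?_
  rw [lintegral_indicator (hs i), h i, withDensity_apply _ (hs i)]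

lemma complexGaussian_map_add (a : ℂ) :
    complexGaussian.map (fun z => z + a) = complexGaussian.withDensity
      (fun z => ENNReal.ofReal (Real.exp (2 * (conj a * z).re - (conj a * a).re))) := by
  ext s hs
  have hm : Measurable fun z : ℂ => z + a := by fun_prop
  rw [Measure.map_apply hm hs, withDensity_apply _ hs, complexGaussian_eq_withDensity,
    withDensity_apply _ (hm hs), setLIntegral_withDensity_eq_setLIntegral_mul _ (by fun_prop)
      (by fun_prop) hs, ← lintegral_indicator (hm hs), ← lintegral_indicator hs,
    ← lintegral_add_right_eq_self (s.indicator _) a]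
  refine lintegral_congr fun z => ?_
  by_cases hz : z + a ∈ s
  · rw [Set.indicator_of_mem (show z ∈ (fun z => z + a) ⁻¹' s from hz), Set.indicator_of_mem hz,
      Pi.mul_apply, ← ENNReal.ofReal_mul (by positivity), mul_assoc, ← Real.exp_add]
    congr 3
    simp only [Complex.sq_norm, Complex.normSq_apply, Complex.mul_re, Complex.conj_re,
      Complex.conj_im, Complex.add_re, Complex.add_im]
    ring
  · rw [Set.indicator_of_notMem (show z ∉ (fun z => z + a) ⁻¹' s from hz),
      Set.indicator_of_notMem hz]

lemma pi_complexGaussian_map_add {n : ℕ} (a : Fin n → ℂ) :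
    (Measure.pi fun _ : Fin n => complexGaussian).map (fun x => x + a) =
      (Measure.pi fun _ : Fin n => complexGaussian).withDensity
        (fun x => ENNReal.ofReal (Real.exp (2 * vecInner a x - vecInner a a))) := by
  refine (pi_map_eq_withDensity (fun _ : Fin n => complexGaussian) (f := fun j z => z + a j)
    (fun j => measurable_id.add_const _) (fun j => by fun_prop)
    (fun j => complexGaussian_map_add (a j))).trans ?_
  congr 1
  ext x
  rw [← ENNReal.ofReal_prod_of_nonneg (fun _ _ => (Real.exp_pos _).le), ← Real.exp_sum]
  simp only [vecInner, Finset.sum_sub_distrib, Finset.mul_sum]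

lemma measurable_vecInner {n : ℕ} (a : Fin n → ℂ) : Measurable (vecInner a) := by
  unfold vecInner
  fun_prop

/-- The Cameron–Martin formula: the translate of the Gaussian law by `a` has density
`exp (2 ⟨a, x⟩ - ⟨a, a⟩)`. -/
lemma gaussianArray_map_add {m n : ℕ} (a : CArray m n) :
    (gaussianArray m n).map (fun x => x + a) = (gaussianArray m n).withDensity
      (fun x => ENNReal.ofReal (Real.exp (2 * arrayInner a x - arrayInner a a))) := by
  have hd : ∀ i, Measurable fun x : Fin n → ℂ =>
      ENNReal.ofReal (Real.exp (2 * vecInner (a i) x - vecInner (a i) (a i))) := fun i => by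
    have := measurable_vecInner (a i)
    fun_prop
  have h2 := pi_map_eq_withDensity (fun _ : Fin m => Measure.pi fun _ : Fin n => complexGaussian)
    (f := fun i x => x + a i) (fun i => measurable_id.add_const _) hd
    (fun i => pi_complexGaussian_map_add (a i))
  have h3 : (fun x : CArray m n => ∏ i, ENNReal.ofReal
      (Real.exp (2 * vecInner (a i) (x i) - vecInner (a i) (a i)))) =
      fun x => ENNReal.ofReal (Real.exp (2 * arrayInner a x - arrayInner a a)) := by
    ext x
    rw [← ENNReal.ofReal_prod_of_nonneg (fun _ _ => (Real.exp_pos _).le), ← Real.exp_sum]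
    simp only [arrayInner, Finset.sum_sub_distrib, Finset.mul_sum]
  rw [h3] at h2
  exact h2

lemma measurable_arrayInner {m n : ℕ} (a : CArray m n) : Measurable (arrayInner a) := by
  unfold arrayInner vecInner
  fun_prop

lemma lintegral_gaussianArray_add {m n : ℕ} (a : CArray m n) {F : CArray m n → ENNReal}
    (hF : Measurable F) :
    ∫⁻ x, F (x + a) ∂(gaussianArray m n) = ∫⁻ x,
      ENNReal.ofReal (Real.exp (2 * arrayInner a x - arrayInner a a)) * F x
        ∂(gaussianArray m n) := by
  have hd : Measurable fun x : CArray m n =>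
      ENNReal.ofReal (Real.exp (2 * arrayInner a x - arrayInner a a)) := by
    have := measurable_arrayInner a
    fun_prop
  rw [← lintegral_map (f := F) (g := fun x => x + a) hF (by fun_prop), gaussianArray_map_add,
    lintegral_withDensity_eq_lintegral_mul _ hd hF]
  rfl

lemma complexGaussian_map_neg : complexGaussian.map (fun z => -z) = complexGaussian := by
  ext s hs
  have hm : Measurable fun z : ℂ => -z := by fun_prop
  rw [Measure.map_apply hm hs, complexGaussian_eq_withDensity, withDensity_apply _ hs,
    withDensity_apply _ (hm hs),
    ← (Measure.measurePreserving_neg (volume : Measure ℂ)).setLIntegral_comp_preimage hs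
      (by fun_prop)]
  simp

lemma lintegral_gaussianArray_neg {m n : ℕ} {F : CArray m n → ENNReal}
    (hF : Measurable F) :
    ∫⁻ x, F (-x) ∂(gaussianArray m n) = ∫⁻ x, F x ∂(gaussianArray m n) := by
  have h : (gaussianArray m n).map (fun x => -x) = gaussianArray m n := by
    have h1 : (Measure.pi fun _ : Fin n => complexGaussian).map (fun x j => -x j) =
        Measure.pi fun _ : Fin n => complexGaussian := by
      have : IsProbabilityMeasure (complexGaussian.map (fun z => -z)) := by
        rw [complexGaussian_map_neg]; infer_instance
      rw [Measure.pi_map_pi (f := fun _ z => -z) fun _ => measurable_neg.aemeasurable]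
      simp_rw [complexGaussian_map_neg]
    have : IsProbabilityMeasure ((Measure.pi fun _ : Fin n => complexGaussian).map
        (fun x j => -x j)) := by rw [h1]; infer_instance
    rw [gaussianArray]
    refine (Measure.pi_map_pi (f := fun _ (x : Fin n → ℂ) j => -x j)
      fun _ => measurable_neg.aemeasurable).trans ?_
    simp_rw [h1]
  conv_rhs => rw [← h]
  rw [lintegral_map hF (by fun_prop)]

/-! ### Small balls, negative moments and variances -/

lemma complexGaussian_ball_ge {r : ℝ} (h0 : 0 ≤ r) (h1 : r ≤ 1) :
    ENNReal.ofReal (Real.exp (-1) * r ^ 2) ≤ complexGaussian (Metric.ball 0 r) := by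
  rw [complexGaussian_eq_withDensity, withDensity_apply _ Metric.isOpen_ball.measurableSet]
  calc ENNReal.ofReal (Real.exp (-1) * r ^ 2)
      = ENNReal.ofReal (Real.pi⁻¹ * Real.exp (-1)) * volume (Metric.ball (0 : ℂ) r) := by
        rw [Complex.volume_ball, ← ENNReal.ofReal_pow h0, ← ENNReal.ofReal_coe_nnreal,
          ← ENNReal.ofReal_mul (by positivity), ← ENNReal.ofReal_mul (by positivity)]
        congr 1
        have := Real.pi_ne_zero
        rw [NNReal.coe_real_pi]
        field_simp
    _ = ∫⁻ _ in Metric.ball (0 : ℂ) r, ENNReal.ofReal (Real.pi⁻¹ * Real.exp (-1)) := by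
        rw [setLIntegral_const]
    _ ≤ _ := by
        refine setLIntegral_mono' Metric.isOpen_ball.measurableSet fun z hz => ?_
        refine ENNReal.ofReal_le_ofReal ?_
        have hz : ‖z‖ < r := by simpa using hz
        have : ‖z‖ ^ 2 ≤ 1 := by nlinarith [norm_nonneg z]
        gcongr

lemma complexGaussian_ae_ne_zero : ∀ᵐ z ∂complexGaussian, z ≠ 0 := by
  rw [complexGaussian_eq_withDensity]
  refine (withDensity_absolutelyContinuous _ _).ae_le ?_
  exact measure_eq_zero_iff_ae_notMem.1 (measure_singleton (0 : ℂ))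

lemma measurePreserving_gaussianArray_apply {m n : ℕ} (i : Fin m) (j : Fin n) :
    MeasurePreserving (fun x : CArray m n => x i j) (gaussianArray m n) complexGaussian :=
  (measurePreserving_eval (fun _ : Fin n => complexGaussian) j).comp
    (measurePreserving_eval (fun _ : Fin m => Measure.pi fun _ : Fin n => complexGaussian) i)

lemma gaussianArray_ae_ne_zero (m n : ℕ) : ∀ᵐ x ∂(gaussianArray m n), ∀ i j, x i j ≠ 0 := by
  simp only [ae_all_iff]
  exact fun i j => (measurePreserving_gaussianArray_apply i j).quasiMeasurePreserving.ae
    complexGaussian_ae_ne_zero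

/-- Negative moments of `CN(0,1)` of order less than two are finite, also with a polynomial
weight. -/
lemma lintegral_complexGaussian_rpow_lt_top {q : ℝ} (hq : -2 < q) {p : ℝ} (hp : 0 ≤ p) :
    ∫⁻ z, ENNReal.ofReal (‖z‖ ^ q * (1 + ‖z‖ ^ 2) ^ p) ∂complexGaussian < ⊤ := by
  obtain ⟨C, hC, hbound⟩ : ∃ C : ℝ, 0 < C ∧
      ∀ x : ℝ, 0 ≤ x → (1 + x) ^ p * Real.exp (-x) ≤ C * Real.exp (-(1 / 2) * x) := by
    refine ⟨(2 * p + 1) ^ p * Real.exp (1 / 2), by positivity, fun x hx => ?_⟩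
    have h1 : 1 + x ≤ (2 * p + 1) * Real.exp ((1 + x) / (2 * p + 1)) := by
      have := Real.add_one_le_exp ((1 + x) / (2 * p + 1))
      have h2 : (1 + x) / (2 * p + 1) ≤ Real.exp ((1 + x) / (2 * p + 1)) := by linarith
      rwa [div_le_iff₀' (by positivity)] at h2
    have h2 : (1 + x) ^ p ≤ (2 * p + 1) ^ p * Real.exp ((1 + x) / 2) := by
      calc (1 + x) ^ p ≤ ((2 * p + 1) * Real.exp ((1 + x) / (2 * p + 1))) ^ p := by gcongr
        _ = (2 * p + 1) ^ p * Real.exp ((1 + x) / (2 * p + 1) * p) := by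
          rw [Real.mul_rpow (by positivity) (by positivity), Real.exp_mul]
        _ ≤ _ := by
          gcongr
          rw [div_mul_eq_mul_div, div_le_div_iff₀ (by positivity) (by positivity)]
          nlinarith
    calc (1 + x) ^ p * Real.exp (-x)
        ≤ (2 * p + 1) ^ p * Real.exp ((1 + x) / 2) * Real.exp (-x) := by gcongr
      _ = _ := by
        rw [mul_assoc, mul_assoc, ← Real.exp_add, ← Real.exp_add]
        congr 2
        ring
  have hint : Integrable fun z : ℂ => ‖z‖ ^ q * Real.exp (-(1 / 2) * ‖z‖ ^ (2 : ℝ)) := by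
    -- the value of the integral is not `0`, the junk value at functions that are not integrable
    refine not_imp_comm.1 integral_undef ?_
    rw [Complex.integral_rpow_mul_exp_neg_mul_rpow one_le_two hq (by norm_num)]
    have : 0 < Real.Gamma ((q + 2) / 2) := Real.Gamma_pos_of_pos (by linarith)
    positivity
  rw [complexGaussian_eq_withDensity,
    lintegral_withDensity_eq_lintegral_mul _ (by fun_prop) (by fun_prop)]
  refine lt_of_le_of_lt (lintegral_mono fun z => ?_)
    ((hint.const_mul (Real.pi⁻¹ * C)).lintegral_lt_top)
  rw [Pi.mul_apply, ← ENNReal.ofReal_mul (by positivity)]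
  refine ENNReal.ofReal_le_ofReal ?_
  rw [Real.rpow_two]
  have := hbound (‖z‖ ^ 2) (by positivity)
  calc Real.pi⁻¹ * Real.exp (-‖z‖ ^ 2) * (‖z‖ ^ q * (1 + ‖z‖ ^ 2) ^ p)
      = Real.pi⁻¹ * ‖z‖ ^ q * ((1 + ‖z‖ ^ 2) ^ p * Real.exp (-‖z‖ ^ 2)) := by ring
    _ ≤ Real.pi⁻¹ * ‖z‖ ^ q * (C * Real.exp (-(1 / 2) * ‖z‖ ^ 2)) := by gcongr
    _ = _ := by ring

/-- The real random variable `f` is centred and square integrable, with variance `v`. -/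
structure HasCenteredVariance {Ω : Type*} [MeasurableSpace Ω] (μ : Measure Ω) (f : Ω → ℝ) (v : ℝ) :
    Prop where
  memLp : MemLp f 2 μ
  integral_eq : ∫ x, f x ∂μ = 0
  integral_sq : ∫ x, f x ^ 2 ∂μ = v

lemma HasCenteredVariance.pi {ι : Type*} [Fintype ι] {Ω : ι → Type*} [∀ i, MeasurableSpace (Ω i)]
    {μ : ∀ i, Measure (Ω i)} [∀ i, IsProbabilityMeasure (μ i)] {f : ∀ i, Ω i → ℝ} {v : ι → ℝ}
    (h : ∀ i, HasCenteredVariance (μ i) (f i) (v i)) :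
    HasCenteredVariance (Measure.pi μ) (fun x => ∑ i, f i (x i)) (∑ i, v i) := by
  have hmp := measurePreserving_eval μ
  have hL : ∀ i, MemLp (fun x : ∀ i, Ω i => f i (x i)) 2 (Measure.pi μ) := fun i =>
    (h i).memLp.comp_measurePreserving (hmp i)
  have hI : ∫ x, ∑ i, f i (x i) ∂(Measure.pi μ) = 0 := by
    rw [integral_finsetSum _ fun i _ => (hL i).integrable one_le_two]
    refine Finset.sum_eq_zero fun i _ => ?_
    rw [← (h i).integral_eq, ← (hmp i).map_eq, integral_map (hmp i).measurable.aemeasurable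
      (by rw [(hmp i).map_eq]; exact (h i).memLp.1)]
  have hS : MemLp (fun x : ∀ i, Ω i => ∑ i, f i (x i)) 2 (Measure.pi μ) :=
    memLp_finsetSum _ fun i _ => hL i
  refine ⟨hS, hI, ?_⟩
  have hv := variance_sum_pi (μ := μ) fun i => (h i).memLp
  have he : (∑ i, fun x : ∀ i, Ω i => f i (x i)) = fun x => ∑ i, f i (x i) := by
    ext x; simp
  rw [he, variance_of_integral_eq_zero hS.1.aemeasurable hI] at hv
  rw [hv]
  refine Finset.sum_congr rfl fun i _ => ?_
  rw [variance_of_integral_eq_zero (h i).memLp.1.aemeasurable (h i).integral_eq,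
    (h i).integral_sq]

lemma hasCenteredVariance_complexGaussian (a : ℂ) :
    HasCenteredVariance complexGaussian (fun z => (conj a * z).re) (‖a‖ ^ 2 / 2) := by
  set γ := gaussianReal 0 (1 / 2) with hγ
  have hm : Measurable (fun p : ℝ × ℝ => (⟨p.1, p.2⟩ : ℂ)) :=
    Complex.measurableEquivRealProd.symm.measurable
  have hf : Measurable fun z : ℂ => (conj a * z).re := by fun_prop
  have hid : MemLp id 2 γ := memLp_id_gaussianReal 2
  have hid' : Integrable (fun x : ℝ => x) γ := hid.integrable one_le_two
  have h0 : ∫ x, x ∂γ = 0 := integral_id_gaussianReal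
  have h2 : ∫ x, x ^ 2 ∂γ = 1 / 2 := by
    have := variance_fun_id_gaussianReal (μ := 0) (v := 1 / 2)
    rw [variance_of_integral_eq_zero (by fun_prop) h0] at this
    rw [hγ, this]
    norm_num
  have hsq : Integrable (fun x : ℝ => x ^ 2) γ := hid.integrable_sq
  have heq : ∀ p : ℝ × ℝ, (conj a * (⟨p.1, p.2⟩ : ℂ)).re = a.re * p.1 + a.im * p.2 := by
    intro p; simp [Complex.mul_re]
  have i1 : Integrable (fun p : ℝ × ℝ => p.1) (γ.prod γ) := hid'.comp_fst γ
  have i2 : Integrable (fun p : ℝ × ℝ => p.2) (γ.prod γ) := hid'.comp_snd γ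
  have i3 : Integrable (fun p : ℝ × ℝ => p.1 ^ 2) (γ.prod γ) := hsq.comp_fst γ
  have i4 : Integrable (fun p : ℝ × ℝ => p.2 ^ 2) (γ.prod γ) := hsq.comp_snd γ
  have i5 : Integrable (fun p : ℝ × ℝ => p.1 * p.2) (γ.prod γ) := hid'.mul_prod hid'
  have e1 : ∫ p, p.1 ∂(γ.prod γ) = 0 := by
    rw [integral_fun_fst (fun x : ℝ => x), h0, smul_zero]
  have e2 : ∫ p, p.2 ∂(γ.prod γ) = 0 := by
    rw [integral_fun_snd (fun x : ℝ => x), h0, smul_zero]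
  have e3 : ∫ p, p.1 ^ 2 ∂(γ.prod γ) = 1 / 2 := by
    rw [integral_fun_fst (fun x : ℝ => x ^ 2), h2]; simp
  have e4 : ∫ p, p.2 ^ 2 ∂(γ.prod γ) = 1 / 2 := by
    rw [integral_fun_snd (fun x : ℝ => x ^ 2), h2]; simp
  have e5 : ∫ p, p.1 * p.2 ∂(γ.prod γ) = 0 := by
    rw [integral_prod_mul (fun x : ℝ => x) (fun x : ℝ => x), h0, zero_mul]
  have hsqeq : ∀ p : ℝ × ℝ, (a.re * p.1 + a.im * p.2) ^ 2 =
      a.re ^ 2 * p.1 ^ 2 + (2 * a.re * a.im) * (p.1 * p.2) + a.im ^ 2 * p.2 ^ 2 := by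
    intro p; ring
  refine ⟨?_, ?_, ?_⟩
  · rw [complexGaussian, memLp_map_measure_iff hf.aestronglyMeasurable hm.aemeasurable]
    have : (fun z : ℂ => (conj a * z).re) ∘ (fun p : ℝ × ℝ => (⟨p.1, p.2⟩ : ℂ)) =
        fun p => a.re * p.1 + a.im * p.2 := funext heq
    rw [this, memLp_two_iff_integrable_sq (by fun_prop)]
    simp_rw [hsqeq]
    exact ((i3.const_mul _).add (i5.const_mul _)).add (i4.const_mul _)
  · rw [complexGaussian, integral_map hm.aemeasurable hf.aestronglyMeasurable]
    simp_rw [heq]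
    rw [integral_add (i1.const_mul _) (i2.const_mul _), integral_const_mul, integral_const_mul,
      e1, e2]
    simp
  · rw [complexGaussian, integral_map hm.aemeasurable (by fun_prop)]
    simp_rw [heq, hsqeq]
    rw [integral_add (f := fun p : ℝ × ℝ => a.re ^ 2 * p.1 ^ 2 + (2 * a.re * a.im) * (p.1 * p.2))
        ((i3.const_mul _).add (i5.const_mul _)) (i4.const_mul _),
      integral_add (i3.const_mul _) (i5.const_mul _), integral_const_mul, integral_const_mul,
      integral_const_mul, e3, e4, e5, Complex.sq_norm, Complex.normSq_apply]
    ring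

lemma vecInner_self {ι : Type*} [Fintype ι] (x : ι → ℂ) : vecInner x x = ∑ i, ‖x i‖ ^ 2 := by
  refine Finset.sum_congr rfl fun i _ => ?_
  rw [← Complex.normSq_eq_conj_mul_self, Complex.ofReal_re, Complex.sq_norm]

lemma hasCenteredVariance_arrayInner {m n : ℕ} (a : CArray m n) :
    HasCenteredVariance (gaussianArray m n) (arrayInner a) (arrayInner a a / 2) := by
  have h : HasCenteredVariance (gaussianArray m n)
      (fun x => ∑ i, vecInner (a i) (x i)) (∑ i, ∑ j, ‖a i j‖ ^ 2 / 2) :=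
    HasCenteredVariance.pi fun i =>
      HasCenteredVariance.pi fun j => hasCenteredVariance_complexGaussian (a i j)
  simp only [arrayInner, vecInner_self, Finset.sum_div]
  exact h

lemma integral_complexGaussian_normSq : ∫ z, ‖z‖ ^ 2 ∂complexGaussian = 1 ∧
    Integrable (fun z : ℂ => ‖z‖ ^ 2) complexGaussian := by
  have h1 := hasCenteredVariance_complexGaussian 1
  have h2 := hasCenteredVariance_complexGaussian Complex.I
  have he : ∀ z : ℂ, ‖z‖ ^ 2 = (conj 1 * z).re ^ 2 + (conj Complex.I * z).re ^ 2 := by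
    intro z
    simp [Complex.sq_norm, Complex.normSq_apply, Complex.mul_re]
    ring
  simp_rw [he]
  refine ⟨?_, h1.memLp.integrable_sq.add h2.memLp.integrable_sq⟩
  rw [integral_add h1.memLp.integrable_sq h2.memLp.integrable_sq, h1.integral_sq, h2.integral_sq]
  norm_num

/-! ### Testing between two translates of a Gaussian noise law -/

/-- Complex arrays as a real Hilbert space whose inner product is `arrayInner`. -/
def arrayToHilbert (m n : ℕ) :
    CArray m n ≃ₗ[ℝ] PiLp 2 (fun _ : Fin m => PiLp 2 (fun _ : Fin n => ℂ)) :=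
  (LinearEquiv.piCongrRight fun _ => (WithLp.linearEquiv 2 ℝ (Fin n → ℂ)).symm).trans
    (WithLp.linearEquiv 2 ℝ (Fin m → PiLp 2 (fun _ : Fin n => ℂ))).symm

lemma inner_arrayToHilbert {m n : ℕ} (x y : CArray m n) :
    inner ℝ (arrayToHilbert m n x) (arrayToHilbert m n y) = arrayInner x y := by
  simp only [PiLp.inner_apply, arrayInner, vecInner, Complex.inner]
  simp_rw [mul_comm (conj _)]
  rfl

lemma norm_sq_arrayToHilbert {m n : ℕ} (x : CArray m n) :
    ‖arrayToHilbert m n x‖ ^ 2 = arrayInner x x := by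
  rw [← inner_arrayToHilbert, real_inner_self_eq_norm_sq]

lemma arrayInner_self {m n : ℕ} (x : CArray m n) : arrayInner x x = ∑ i, ∑ j, ‖x i j‖ ^ 2 := by
  simp only [arrayInner, vecInner_self]

lemma arrayInner_self_nonneg {m n : ℕ} (x : CArray m n) : 0 ≤ arrayInner x x := by
  rw [← norm_sq_arrayToHilbert]; positivity

lemma arrayInner_add_right {m n : ℕ} (x y z : CArray m n) :
    arrayInner x (y + z) = arrayInner x y + arrayInner x z := by
  simp only [← inner_arrayToHilbert, map_add, inner_add_right]

lemma arrayInner_smul_left {m n : ℕ} (t : ℝ) (x y : CArray m n) :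
    arrayInner (t • x) y = t * arrayInner x y := by
  simp only [← inner_arrayToHilbert, map_smul, real_inner_smul_left]

lemma arrayInner_smul_right {m n : ℕ} (t : ℝ) (x y : CArray m n) :
    arrayInner x (t • y) = t * arrayInner x y := by
  simp only [← inner_arrayToHilbert, map_smul, real_inner_smul_right]

lemma arrayInner_neg_right {m n : ℕ} (x y : CArray m n) :
    arrayInner x (-y) = -arrayInner x y := by
  simp only [← inner_arrayToHilbert, map_neg, inner_neg_right]

lemma arrayInner_sub_right {m n : ℕ} (x y z : CArray m n) :
    arrayInner x (y - z) = arrayInner x y - arrayInner x z := by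
  simp only [← inner_arrayToHilbert, map_sub, inner_sub_right]

lemma arrayInner_add_self {m n : ℕ} (x y : CArray m n) :
    arrayInner (x + y) (x + y) = arrayInner x x + 2 * arrayInner x y + arrayInner y y := by
  simp only [← inner_arrayToHilbert, map_add]
  rw [real_inner_add_add_self]

section TwoHypotheses

variable {k l m n : ℕ}

/-- For real-linear `N` with transpose `Nᵀ`, the equation `u + N Nᵀ u = δ` is solvable; `a` is
`Nᵀ u`. -/
lemma exists_add_map_transpose_eq (N : CArray k l →ₗ[ℝ] CArray m n) (δ : CArray m n) :
    ∃ (u : CArray m n) (a : CArray k l),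
      (∀ x, arrayInner a x = arrayInner u (N x)) ∧ u + N a = δ := by
  let e₁ := arrayToHilbert k l
  let e₂ := arrayToHilbert m n
  let T := e₂.toLinearMap ∘ₗ N ∘ₗ e₁.symm.toLinearMap
  let T' := LinearMap.adjoint T
  let S := LinearMap.id + T ∘ₗ T'
  have hinj : Function.Injective S := by
    rw [← LinearMap.ker_eq_bot, LinearMap.ker_eq_bot']
    intro v hv
    have h : inner ℝ v (S v) = 0 := by rw [hv, inner_zero_right]
    rw [LinearMap.add_apply, inner_add_right, LinearMap.id_apply, LinearMap.comp_apply,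
      ← LinearMap.adjoint_inner_left, real_inner_self_eq_norm_sq, real_inner_self_eq_norm_sq] at h
    have : ‖v‖ ^ 2 = 0 := by nlinarith [sq_nonneg ‖v‖, sq_nonneg ‖T' v‖]
    simpa using this
  obtain ⟨v, hv⟩ := LinearMap.injective_iff_surjective.1 hinj (e₂ δ)
  refine ⟨e₂.symm v, e₁.symm (T' v), fun x => ?_, ?_⟩
  · rw [← inner_arrayToHilbert, ← inner_arrayToHilbert]
    change inner ℝ (e₁ (e₁.symm _)) (e₁ x) = inner ℝ (e₂ (e₂.symm _)) (e₂ (N x))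
    rw [LinearEquiv.apply_symm_apply, LinearEquiv.apply_symm_apply, LinearMap.adjoint_inner_left]
    simp [T]
  · apply e₂.injective
    rw [map_add, LinearEquiv.apply_symm_apply, ← hv]
    rfl

/-- The squared distance `⟨δ, (1 + N Nᵀ)⁻¹ δ⟩ = |u|² + |Nᵀ u|²` between the two hypotheses is at
least `|δ|² / (1 + ν²)` when `N` has norm at most `ν`. -/
lemma arrayInner_le_of_add_map_eq {N : CArray k l →ₗ[ℝ] CArray m n} {u δ : CArray m n}
    {a : CArray k l} (hδ : u + N a = δ)
    {ν : ℝ} (hν : 0 ≤ ν) (hN : ∀ x, arrayInner (N x) (N x) ≤ ν * arrayInner x x) :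
    arrayInner δ δ ≤ (1 + ν) * (arrayInner a a + arrayInner u u) := by
  have h1 : arrayInner δ δ = ‖arrayToHilbert m n (u + N a)‖ ^ 2 := by
    rw [norm_sq_arrayToHilbert, hδ]
  have h2 := hN a
  rw [← norm_sq_arrayToHilbert, ← norm_sq_arrayToHilbert] at h2
  rw [h1, map_add, ← norm_sq_arrayToHilbert, ← norm_sq_arrayToHilbert]
  set p := ‖arrayToHilbert m n u‖
  set q := ‖arrayToHilbert m n (N a)‖
  set r := ‖arrayToHilbert k l a‖
  have h3 : ‖arrayToHilbert m n u + arrayToHilbert m n (N a)‖ ≤ p + q := norm_add_le _ _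
  have h4 : ‖arrayToHilbert m n u + arrayToHilbert m n (N a)‖ ^ 2 ≤ (p + q) ^ 2 := by gcongr
  have h5 : 0 ≤ (ν * p ^ 2 + r ^ 2) - 2 * p * q := by
    have hq : q ≤ √ν * r := by
      refine (sq_le_sq₀ (norm_nonneg _) (by positivity)).1 ?_
      rw [mul_pow, Real.sq_sqrt hν]; exact h2
    have hs : √ν ^ 2 = ν := Real.sq_sqrt hν
    have : p * q ≤ p * (√ν * r) := by gcongr
    nlinarith [sq_nonneg (√ν * p - r)]
  nlinarith

lemma le_arrayInner_of_add_map_eq {N : CArray k l →ₗ[ℝ] CArray m n} {u δ : CArray m n}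
    {a : CArray k l} (ha : ∀ x, arrayInner a x = arrayInner u (N x)) (hδ : u + N a = δ) :
    arrayInner a a + arrayInner u u ≤ arrayInner δ δ := by
  have h := arrayInner_add_self u (N a)
  rw [hδ, ← ha a] at h
  have := arrayInner_self_nonneg (N a)
  have := arrayInner_self_nonneg a
  linarith

lemma measurable_real_linearMap (N : CArray k l →ₗ[ℝ] CArray m n) : Measurable N :=
  N.continuous_of_finiteDimensional.measurable

lemma integral_gaussianArray_add (a : CArray k l) {F : CArray k l → ℝ} (hF : Measurable F) :
    ∫ x, F (x + a) ∂(gaussianArray k l) = ∫ x,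
      Real.exp (2 * arrayInner a x - arrayInner a a) * F x ∂(gaussianArray k l) := by
  have hd : Measurable fun x : CArray k l =>
      ENNReal.ofReal (Real.exp (2 * arrayInner a x - arrayInner a a)) := by
    have := measurable_arrayInner a
    fun_prop
  rw [← integral_map (φ := fun x => x + a) (measurable_add_const a).aemeasurable
      hF.aestronglyMeasurable,
    gaussianArray_map_add, integral_withDensity_eq_integral_toReal_smul hd (by simp)]
  simp_rw [ENNReal.toReal_ofReal (Real.exp_pos _).le, smul_eq_mul]

/-- The density (up to the factor `C`) at `v` of the noise `N n + z`, for standard Gaussian `n` and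
`z`. -/
def noiseDensity (C : ℝ) (N : CArray k l →ₗ[ℝ] CArray m n) (v : CArray m n) : ℝ :=
  ∫ x, C * Real.exp (-arrayInner (v - N x) (v - N x)) ∂(gaussianArray k l)

lemma measurable_exp_neg_arrayInner (N : CArray k l →ₗ[ℝ] CArray m n) (v : CArray m n) :
    Measurable fun x => Real.exp (-arrayInner (v - N x) (v - N x)) := by
  have := measurable_real_linearMap N
  simp only [arrayInner_self]
  fun_prop

lemma noiseDensity_pos {C : ℝ} (hC : 0 < C) (N : CArray k l →ₗ[ℝ] CArray m n)
    (v : CArray m n) : 0 < noiseDensity C N v := by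
  have hi : Integrable (fun x => Real.exp (-arrayInner (v - N x) (v - N x)))
      (gaussianArray k l) := by
    refine Integrable.of_bound (measurable_exp_neg_arrayInner N v).aestronglyMeasurable 1 ?_
    refine ae_of_all _ fun x => ?_
    rw [Real.norm_eq_abs, abs_of_pos (Real.exp_pos _), Real.exp_le_one_iff, neg_nonpos]
    exact arrayInner_self_nonneg _
  rw [noiseDensity, integral_const_mul]
  exact mul_pos hC (integral_exp_pos hi)

/-- Translating the noise density by `δ = u + N Nᵀ u` multiplies it by the exponential of an affine
function: the substitution `x ↦ x + Nᵀ u` of the Gaussian variable absorbs the part `N Nᵀ u`, and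
the terms coupling `x` with `u` cancel. -/
lemma noiseDensity_add (C : ℝ) {N : CArray k l →ₗ[ℝ] CArray m n} {u δ : CArray m n}
    {a : CArray k l} (ha : ∀ x, arrayInner a x = arrayInner u (N x)) (hδ : u + N a = δ)
    (v : CArray m n) :
    noiseDensity C N (v + δ) =
      Real.exp (-(2 * arrayInner u v + (arrayInner a a + arrayInner u u))) *
        noiseDensity C N v := by
  have hF : Measurable fun x => Real.exp (-(2 * arrayInner a x - arrayInner a a)) *
      (C * Real.exp (-arrayInner (v + δ - N x) (v + δ - N x))) := by
    have h1 := measurable_exp_neg_arrayInner N (v + δ)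
    have h2 := measurable_arrayInner a
    fun_prop
  have h := integral_gaussianArray_add a hF
  simp_rw [← mul_assoc (Real.exp _) (Real.exp _), ← Real.exp_add, add_neg_cancel, Real.exp_zero,
    one_mul] at h
  rw [noiseDensity, noiseDensity, ← h, ← integral_const_mul]
  refine integral_congr_ae (ae_of_all _ fun x => ?_)
  have e1 : v + δ - N (x + a) = u + (v - N x) := by
    rw [← hδ, map_add]; abel
  have e2 : arrayInner (u + (v - N x)) (u + (v - N x)) =
      arrayInner u u + 2 * (arrayInner u v - arrayInner a x) +
        arrayInner (v - N x) (v - N x) := by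
    rw [arrayInner_add_self, arrayInner_sub_right, ha]
  simp only [e1, e2, arrayInner_add_right]
  rw [mul_left_comm, mul_left_comm (Real.exp _) C, ← Real.exp_add, ← Real.exp_add]
  congr 2
  ring

/-- A real-linear functional of two independent Gaussian arrays. -/
def jointFunctional (a : CArray k l) (u : CArray m n) (p : CArray k l × CArray m n) : ℝ :=
  arrayInner a p.1 + arrayInner u p.2

lemma measurable_jointFunctional (a : CArray k l) (u : CArray m n) :
    Measurable (jointFunctional a u) :=
  ((measurable_arrayInner a).comp measurable_fst).add ((measurable_arrayInner u).comp measurable_snd)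

/-- One-dimensional Cameron–Martin formula for the law of a real-linear functional `ξ` of variance
`Q / 2`, tested on a function `f` of `ξ`. -/
lemma lintegral_jointFunctional_shift (a : CArray k l) (u : CArray m n) {Q : ℝ}
    (hQ : arrayInner a a + arrayInner u u = Q) (t : ℝ) {f : ℝ → ENNReal} (hf : Measurable f) :
    ∫⁻ p, f (jointFunctional a u p + t * Q) ∂((gaussianArray k l).prod (gaussianArray m n)) =
      ∫⁻ p, ENNReal.ofReal (Real.exp (2 * t * jointFunctional a u p - t ^ 2 * Q)) *
        f (jointFunctional a u p) ∂((gaussianArray k l).prod (gaussianArray m n)) := by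
  have hm := measurable_jointFunctional a u
  have hma := measurable_arrayInner a
  have hmu := measurable_arrayInner u
  rw [lintegral_prod _ (by fun_prop), lintegral_prod _ (by fun_prop)]
  have h1 : ∀ x, ∫⁻ y, f (jointFunctional a u (x, y) + t * Q) ∂(gaussianArray m n) =
      ∫⁻ y, ENNReal.ofReal (Real.exp (2 * arrayInner (t • u) y -
        arrayInner (t • u) (t • u))) * f (arrayInner a (x + t • a) + arrayInner u y)
        ∂(gaussianArray m n) := by
    intro x
    rw [← lintegral_gaussianArray_add (t • u)
      (F := fun y => f (arrayInner a (x + t • a) + arrayInner u y)) (by fun_prop)]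
    refine lintegral_congr fun y => ?_
    congr 1
    simp only [jointFunctional, arrayInner_add_right, arrayInner_smul_right, ← hQ]
    ring
  simp_rw [h1]
  rw [lintegral_gaussianArray_add (t • a) (F := fun x => ∫⁻ y, ENNReal.ofReal (Real.exp
    (2 * arrayInner (t • u) y - arrayInner (t • u) (t • u))) *
      f (arrayInner a x + arrayInner u y) ∂(gaussianArray m n))]
  · refine lintegral_congr fun x => ?_
    have hmtu := measurable_arrayInner (t • u)
    rw [← lintegral_const_mul _ (by fun_prop)]
    refine lintegral_congr fun y => ?_
    rw [← mul_assoc, ← ENNReal.ofReal_mul (Real.exp_pos _).le, ← Real.exp_add]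
    congr 3
    simp only [jointFunctional, arrayInner_smul_left, arrayInner_smul_right, ← hQ]
    ring
  · have hmtu := measurable_arrayInner (t • u)
    exact Measurable.lintegral_prod_right (by fun_prop)

lemma lintegral_jointFunctional_neg (a : CArray k l) (u : CArray m n)
    {f : ℝ → ENNReal} (hf : Measurable f) :
    ∫⁻ p, f (-jointFunctional a u p) ∂((gaussianArray k l).prod (gaussianArray m n)) =
      ∫⁻ p, f (jointFunctional a u p) ∂((gaussianArray k l).prod (gaussianArray m n)) := by
  have hm := measurable_jointFunctional a u
  have hma := measurable_arrayInner a
  have hmu := measurable_arrayInner u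
  rw [lintegral_prod _ (by fun_prop), lintegral_prod _ (by fun_prop)]
  rw [← lintegral_gaussianArray_neg (F := fun x => ∫⁻ y, f (jointFunctional a u (x, y))
    ∂(gaussianArray m n)) (Measurable.lintegral_prod_right (by fun_prop))]
  refine lintegral_congr fun x => ?_
  rw [← lintegral_gaussianArray_neg (F := fun y => f (jointFunctional a u (-x, y)))
    (by fun_prop)]
  refine lintegral_congr fun y => ?_
  simp only [jointFunctional, arrayInner_neg_right]
  congr 1
  ring

lemma lintegral_exp_jointFunctional (a : CArray k l) (u : CArray m n) {Q : ℝ}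
    (hQ : arrayInner a a + arrayInner u u = Q) (t : ℝ) :
    ∫⁻ p, ENNReal.ofReal (Real.exp (2 * t * jointFunctional a u p - t ^ 2 * Q))
      ∂((gaussianArray k l).prod (gaussianArray m n)) = 1 := by
  have h := lintegral_jointFunctional_shift a u hQ t (f := fun _ => 1) measurable_const
  simpa using h.symm

/-- Chernoff's bound for the probability that a Gaussian variable `ξ` of variance `Q / 2` is at most
`-Q / 2`. -/
lemma measure_jointFunctional_le (a : CArray k l) (u : CArray m n) {Q : ℝ}
    (hQ : arrayInner a a + arrayInner u u = Q) :
    ((gaussianArray k l).prod (gaussianArray m n)) {p | 2 * jointFunctional a u p + Q ≤ 0} ≤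
      ENNReal.ofReal (Real.exp (-(Q / 4))) := by
  have hm := measurable_jointFunctional a u
  have hs : MeasurableSet {p | 2 * jointFunctional a u p + Q ≤ 0} :=
    measurableSet_le (by fun_prop) measurable_const
  rw [← lintegral_indicator_one hs]
  calc _ ≤ ∫⁻ p, ENNReal.ofReal (Real.exp (-(Q / 4))) * ENNReal.ofReal
          (Real.exp (2 * (-(1 / 2)) * jointFunctional a u p - (-(1 / 2)) ^ 2 * Q))
        ∂((gaussianArray k l).prod (gaussianArray m n)) := by
        refine lintegral_mono fun p => ?_
        by_cases hp : p ∈ {p | 2 * jointFunctional a u p + Q ≤ 0}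
        · rw [Set.indicator_of_mem hp, Pi.one_apply, ← ENNReal.ofReal_mul (Real.exp_pos _).le,
            ← Real.exp_add, ← ENNReal.ofReal_one]
          refine ENNReal.ofReal_le_ofReal (Real.one_le_exp ?_)
          have hp : 2 * jointFunctional a u p + Q ≤ 0 := hp
          nlinarith
        · rw [Set.indicator_of_notMem hp]
          exact zero_le
    _ = _ := by
        rw [lintegral_const_mul _ (by fun_prop), lintegral_exp_jointFunctional a u hQ, mul_one]

/-- A lower bound for the same Gaussian tail. A translation by `Q / 2` moves the threshold to `0`,
the law is symmetric, and `exp (-|ξ|) ≥ 1 / f` for `f = exp ξ + exp (-ξ)`, a function of mean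
`m = 2 exp (Q / 4)`; the tangent inequality `1 / f ≥ 2 / m - f / m ^ 2` gives the mean of `1 / f` the
lower bound `1 / m`. -/
lemma le_measure_jointFunctional (a : CArray k l) (u : CArray m n) {Q : ℝ}
    (hQ : arrayInner a a + arrayInner u u = Q) :
    ENNReal.ofReal (1 / 4 * Real.exp (-(Q / 2))) ≤
      ((gaussianArray k l).prod (gaussianArray m n)) {p | 2 * jointFunctional a u p + Q ≤ 0} := by
  set μ := (gaussianArray k l).prod (gaussianArray m n) with hμ
  set ξ := jointFunctional a u
  have hm : Measurable ξ := measurable_jointFunctional a u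
  have hs : MeasurableSet {p | 2 * ξ p + Q ≤ 0} :=
    measurableSet_le (by fun_prop) measurable_const
  let f : ℝ → ENNReal := fun x => if 2 * x + Q ≤ 0 then
    ENNReal.ofReal (Real.exp (x + Q / 4)) else 0
  have hf : Measurable f :=
    Measurable.ite (measurableSet_le (by fun_prop) measurable_const) (by fun_prop) measurable_const
  let g : ℝ → ENNReal := fun x => if x ≤ 0 then ENNReal.ofReal (Real.exp (x - Q / 4)) else 0
  have hg : Measurable g := Measurable.ite measurableSet_Iic (by fun_prop) measurable_const
  have h1 : μ {p | 2 * ξ p + Q ≤ 0} = ∫⁻ p, g (ξ p) ∂μ := by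
    have hshift := lintegral_jointFunctional_shift a u hQ (-(1 / 2)) hf
    rw [← lintegral_indicator_one hs]
    calc _ = ∫⁻ p, ENNReal.ofReal (Real.exp (2 * (-(1 / 2)) * ξ p - (-(1 / 2)) ^ 2 * Q)) *
          f (ξ p) ∂μ := by
          refine lintegral_congr fun p => ?_
          by_cases hp : 2 * ξ p + Q ≤ 0
          · rw [Set.indicator_of_mem (show p ∈ {p | 2 * ξ p + Q ≤ 0} from hp), Pi.one_apply]
            simp only [f, if_pos hp]
            rw [← ENNReal.ofReal_mul (Real.exp_pos _).le, ← Real.exp_add, eq_comm,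
              ENNReal.ofReal_eq_one, Real.exp_eq_one_iff]
            ring
          · rw [Set.indicator_of_notMem (show p ∉ {p | 2 * ξ p + Q ≤ 0} from hp)]
            simp only [f, if_neg hp, mul_zero]
      _ = _ := by
          rw [← hshift]
          refine lintegral_congr fun p => ?_
          simp only [f, g]
          have e1 : 2 * (jointFunctional a u p + -(1 / 2) * Q) + Q ≤ 0 ↔ ξ p ≤ 0 := by
            constructor <;> intro h <;> simp only [ξ] at * <;> linarith
          simp only [e1]
          congr 3
          simp only [ξ]
          ring
  have h2 : ∫⁻ p, g (-ξ p) ∂μ = ∫⁻ p, g (ξ p) ∂μ := lintegral_jointFunctional_neg a u hg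
  set r := Real.exp (-(Q / 4)) with hr
  have hr0 : 0 < r := Real.exp_pos _
  have h3 : ENNReal.ofReal (r ^ 2) ≤
      ∫⁻ p, (g (ξ p) + g (-ξ p) + ENNReal.ofReal (r ^ 2 / 4) *
        (ENNReal.ofReal (Real.exp (2 * (1 / 2) * ξ p - (1 / 2) ^ 2 * Q)) +
          ENNReal.ofReal (Real.exp (2 * (-(1 / 2)) * ξ p - (-(1 / 2)) ^ 2 * Q)))) ∂μ := by
    calc ENNReal.ofReal (r ^ 2) = ∫⁻ _, ENNReal.ofReal (r ^ 2) ∂μ := by simp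
      _ ≤ _ := by
        refine lintegral_mono fun p => ?_
        have key : ∀ x : ℝ, 0 ≤ x → r ^ 2 ≤ Real.exp (-x - Q / 4) + r ^ 2 / 4 *
            (Real.exp (x - Q / 4) + Real.exp (-x - Q / 4)) := by
          intro x hx
          have e1 : Real.exp (-x - Q / 4) = Real.exp (-x) * r := by
            rw [hr, ← Real.exp_add]; congr 1
          have e2 : Real.exp (x - Q / 4) = Real.exp x * r := by
            rw [hr, ← Real.exp_add]; congr 1
          have hxy : Real.exp x * Real.exp (-x) = 1 := by rw [← Real.exp_add]; simp
          have hx1 : 1 ≤ Real.exp x := Real.one_le_exp hx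
          have hy0 := Real.exp_pos (-x)
          have hy1 : Real.exp (-x) ≤ 1 := Real.exp_le_one_iff.2 (by linarith)
          rw [e1, e2]
          generalize Real.exp x = X at *
          generalize Real.exp (-x) = Y at *
          have hF : 1 ≤ Y * (X + Y) := by nlinarith
          have h5 : r * (X + Y) ≤ (X + Y) * (Y + r ^ 2 / 4 * (X + Y)) := by
            nlinarith [sq_nonneg (r / 2 * (X + Y) - 1)]
          have h6 : r ≤ Y + r ^ 2 / 4 * (X + Y) :=
            le_of_mul_le_mul_left (by linarith) (by linarith : 0 < X + Y)
          nlinarith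
        have hexp : ∀ x : ℝ, 0 ≤ x → ENNReal.ofReal (r ^ 2) ≤
            ENNReal.ofReal (Real.exp (-x - Q / 4)) + ENNReal.ofReal (r ^ 2 / 4) *
              (ENNReal.ofReal (Real.exp (x - Q / 4)) +
                ENNReal.ofReal (Real.exp (-x - Q / 4))) := by
          intro x hx
          rw [← ENNReal.ofReal_add (Real.exp_pos _).le (Real.exp_pos _).le,
            ← ENNReal.ofReal_mul (by positivity),
            ← ENNReal.ofReal_add (Real.exp_pos _).le (by positivity)]
          exact ENNReal.ofReal_le_ofReal (key x hx)
        have e3 : 2 * (1 / 2) * ξ p - (1 / 2) ^ 2 * Q = ξ p - Q / 4 := by ring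
        have e4 : 2 * (-(1 / 2)) * ξ p - (-(1 / 2)) ^ 2 * Q = -ξ p - Q / 4 := by ring
        rw [e3, e4]
        rcases le_total (ξ p) 0 with hx | hx
        · refine (hexp (-ξ p) (by linarith)).trans ?_
          rw [neg_neg, add_comm (ENNReal.ofReal (Real.exp (-ξ p - Q / 4)))]
          gcongr
          simp only [g, if_pos hx]
          exact le_self_add
        · refine (hexp (ξ p) hx).trans ?_
          gcongr
          simp only [g, if_pos (neg_nonpos.2 hx)]
          exact le_add_self
  have hgm : Measurable fun p => g (ξ p) := hg.comp hm
  have hgn : Measurable fun p => g (-ξ p) := hg.comp hm.neg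
  rw [lintegral_add_left (f := fun p => g (ξ p) + g (-ξ p)) (hgm.add hgn),
    lintegral_add_left hgm, h2, ← h1,
    lintegral_const_mul _ (by fun_prop), lintegral_add_left (by fun_prop),
    lintegral_exp_jointFunctional a u hQ, lintegral_exp_jointFunctional a u hQ] at h3
  have e5 : ENNReal.ofReal (r ^ 2 / 4) * (1 + 1) = ENNReal.ofReal (r ^ 2 / 2) := by
    rw [show (1 : ENNReal) + 1 = ENNReal.ofReal 2 by norm_num,
      ← ENNReal.ofReal_mul (by positivity)]
    congr 1
    ring
  have e6 : ENNReal.ofReal (r ^ 2) =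
      2 * ENNReal.ofReal (1 / 4 * Real.exp (-(Q / 2))) + ENNReal.ofReal (r ^ 2 / 2) := by
    have : Real.exp (-(Q / 2)) = r ^ 2 := by
      rw [hr, ← Real.exp_nat_mul]; congr 1; push_cast; ring
    rw [this, show (2 : ENNReal) = ENNReal.ofReal 2 by norm_num,
      ← ENNReal.ofReal_mul (by positivity), ← ENNReal.ofReal_add (by positivity) (by positivity)]
    congr 1
    ring
  rw [e5, e6, ENNReal.add_le_add_iff_right ENNReal.ofReal_ne_top, ← two_mul] at h3
  exact (ENNReal.mul_le_mul_iff_right (by norm_num) (by norm_num)).1 h3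

/-- The event that a sample `N n + z` of the noise is at least as likely under the hypothesis shifted
by `δ` is a half-space in `(n, z)`. -/
lemma setOf_noiseDensity_le_eq {C : ℝ} (hC : 0 < C) {N : CArray k l →ₗ[ℝ] CArray m n}
    {u δ : CArray m n} {a : CArray k l} (ha : ∀ x, arrayInner a x = arrayInner u (N x))
    (hδ : u + N a = δ) :
    {p : CArray k l × CArray m n |
      noiseDensity C N (N p.1 + p.2) ≤ noiseDensity C N (N p.1 + p.2 + δ)} =
    {p | 2 * jointFunctional a u p + (arrayInner a a + arrayInner u u) ≤ 0} := by
  ext p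
  simp only [Set.mem_ofPred_eq]
  rw [noiseDensity_add C ha hδ, le_mul_iff_one_le_left (noiseDensity_pos hC N _),
    Real.one_le_exp_iff, arrayInner_add_right, ← ha, neg_nonneg]
  rfl

end TwoHypotheses

/-! ### Orthogonal designs and the transmit powers -/

section VecInner

variable {ι : Type*} [Fintype ι]

lemma inner_toLp (x y : ι → ℂ) :
    inner ℝ (WithLp.toLp 2 x) (WithLp.toLp 2 y) = vecInner x y := by
  simp only [PiLp.inner_apply, vecInner, Complex.inner]
  exact Finset.sum_congr rfl fun i _ => by rw [mul_comm]

lemma vecInner_self_nonneg (x : ι → ℂ) : 0 ≤ vecInner x x := by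
  rw [vecInner_self]; positivity

lemma vecInner_comm (x y : ι → ℂ) : vecInner x y = vecInner y x := by
  rw [← inner_toLp, ← inner_toLp, real_inner_comm]

lemma vecInner_add_left (x y z : ι → ℂ) : vecInner (x + y) z = vecInner x z + vecInner y z := by
  simp only [← inner_toLp, WithLp.toLp_add, inner_add_left]

lemma vecInner_add_right (x y z : ι → ℂ) : vecInner x (y + z) = vecInner x y + vecInner x z := by
  simp only [← inner_toLp, WithLp.toLp_add, inner_add_right]

lemma vecInner_sub_right (x y z : ι → ℂ) : vecInner x (y - z) = vecInner x y - vecInner x z := by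
  simp only [← inner_toLp, WithLp.toLp_sub, inner_sub_right]

lemma vecInner_smul_left (t : ℝ) (x y : ι → ℂ) : vecInner (t • x) y = t * vecInner x y := by
  simp only [← inner_toLp, WithLp.toLp_smul, real_inner_smul_left]

lemma vecInner_smul_right (t : ℝ) (x y : ι → ℂ) : vecInner x (t • y) = t * vecInner x y := by
  simp only [← inner_toLp, WithLp.toLp_smul, real_inner_smul_right]

lemma vecInner_sq_le (x y : ι → ℂ) : vecInner x y ^ 2 ≤ vecInner x x * vecInner y y := by
  have := real_inner_mul_inner_self_le (WithLp.toLp 2 x) (WithLp.toLp 2 y)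
  simpa only [inner_toLp, sq] using this

lemma vecInner_self_eq_zero {x : ι → ℂ} : vecInner x x = 0 ↔ x = 0 := by
  rw [← inner_toLp, inner_self_eq_zero, WithLp.toLp_eq_zero]

lemma vecInner_left_injective {x y : ι → ℂ} (h : ∀ z, vecInner z x = vecInner z y) : x = y := by
  rw [← sub_eq_zero, ← vecInner_self_eq_zero, vecInner_sub_right, h, sub_self]

lemma vecInner_single [DecidableEq ι] (i : ι) (a : ℂ) (x : ι → ℂ) :
    vecInner (Pi.single i a) x = (conj a * x i).re := by
  rw [vecInner, Finset.sum_eq_single i]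
  · simp
  · intro j _ hj; simp [Pi.single_eq_of_ne hj]
  · simp

end VecInner

namespace STDesign

variable {L T N K : ℕ}

lemma eval_add (D : STDesign L T N) (s s' : Fin L → ℂ) :
    D.eval (s + s') = D.eval s + D.eval s' := by
  simp only [eval, Pi.add_apply, map_add, add_smul, ← Finset.sum_add_distrib]
  exact Finset.sum_congr rfl fun _ _ => by abel

lemma combine_add (D : STDesign L T N) (h : Fin N → ℂ) (r r' : Fin T → ℂ) :
    D.combine h (r + r') = D.combine h r + D.combine h r' := by
  ext l
  simp only [combine, Pi.add_apply, map_add, mul_add, ← Finset.sum_add_distrib]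
  exact Finset.sum_congr rfl fun _ _ => by ring

lemma combine_smul (D : STDesign L T N) (h : Fin N → ℂ) (t : ℝ) (r : Fin T → ℂ) :
    D.combine h (t • r) = t • D.combine h r := by
  ext l
  simp only [combine, Pi.smul_apply, Complex.real_smul, map_mul, Complex.conj_ofReal,
    Finset.mul_sum]
  exact Finset.sum_congr rfl fun _ _ => by ring

/-- Combining with `h` is the real adjoint of `s ↦ D(s) h`. -/
lemma vecInner_combine (D : STDesign L T N) (h : Fin N → ℂ) (s : Fin L → ℂ) (r : Fin T → ℂ) :
    vecInner s (D.combine h r) = vecInner ((D.eval s).mulVec h) r := by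
  have h1 : ∀ t, (D.eval s).mulVec h t = ∑ l, (s l * (D.coef l).mulVec h t +
      conj (s l) * (D.conjCoef l).mulVec h t) := by
    intro t
    simp only [eval, Matrix.sum_mulVec, Matrix.add_mulVec, Matrix.smul_mulVec, Finset.sum_apply,
      Pi.add_apply, Pi.smul_apply, smul_eq_mul]
  simp only [vecInner, h1, combine, map_sum, Finset.sum_mul, Finset.mul_sum, Complex.re_sum]
  rw [Finset.sum_comm]
  refine Finset.sum_congr rfl fun t _ => Finset.sum_congr rfl fun l _ => ?_
  simp only [map_add, map_mul, Complex.conj_conj, Complex.mul_re, Complex.mul_im, Complex.add_re,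
    Complex.add_im, Complex.conj_re, Complex.conj_im]
  ring

lemma IsOrthogonal.conjTranspose_mul {D : STDesign L K K} (hD : D.IsOrthogonal)
    (s : Fin L → ℂ) :
    (D.eval s).conjTranspose * D.eval s =
      ((∑ l, ‖s l‖ ^ 2 : ℝ) : ℂ) • (1 : Matrix (Fin K) (Fin K) ℂ) := by
  by_cases hs : (∑ l, ‖s l‖ ^ 2 : ℝ) = 0
  · have h0 : s = 0 := by rwa [← vecInner_self_eq_zero, vecInner_self]
    rw [hs, h0]
    simp [eval]
  · have hs' : ((∑ l, ‖s l‖ ^ 2 : ℝ) : ℂ) ≠ 0 := by exact_mod_cast hs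
    have h1 : D.eval s * (((∑ l, ‖s l‖ ^ 2 : ℝ) : ℂ)⁻¹ • (D.eval s).conjTranspose) = 1 := by
      rw [Matrix.mul_smul, hD s, smul_smul, inv_mul_cancel₀ hs', one_smul]
    have h2 := mul_eq_one_comm.1 h1
    rw [Matrix.smul_mul] at h2
    rw [← h2, smul_smul, mul_inv_cancel₀ hs', one_smul]

lemma IsOrthogonal.vecInner_mulVec_self {D : STDesign L K K} (hD : D.IsOrthogonal)
    (s : Fin L → ℂ) (h : Fin K → ℂ) :
    vecInner ((D.eval s).mulVec h) ((D.eval s).mulVec h) = vecInner s s * vecInner h h := by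
  have h1 : ∀ x : Fin K → ℂ, ((vecInner x x : ℝ) : ℂ) = dotProduct (star x) x := by
    intro x
    simp only [vecInner_self, dotProduct, Pi.star_apply, Complex.ofReal_sum, Complex.star_def,
      ← Complex.normSq_eq_conj_mul_self, Complex.sq_norm]
  have h2 : ((vecInner ((D.eval s).mulVec h) ((D.eval s).mulVec h) : ℝ) : ℂ) =
      ((vecInner s s * vecInner h h : ℝ) : ℂ) := by
    rw [h1, Matrix.star_mulVec, ← Matrix.dotProduct_mulVec, Matrix.mulVec_mulVec,
      hD.conjTranspose_mul, Matrix.smul_mulVec, Matrix.one_mulVec, dotProduct_smul, ← h1,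
      vecInner_self s, smul_eq_mul, Complex.ofReal_mul]
  exact_mod_cast h2

lemma IsOrthogonal.vecInner_mulVec {D : STDesign L K K} (hD : D.IsOrthogonal)
    (s s' : Fin L → ℂ) (h : Fin K → ℂ) :
    vecInner ((D.eval s).mulVec h) ((D.eval s').mulVec h) = vecInner s s' * vecInner h h := by
  have h1 := hD.vecInner_mulVec_self (s + s') h
  rw [eval_add, Matrix.add_mulVec] at h1
  simp only [vecInner_add_left, vecInner_add_right, hD.vecInner_mulVec_self] at h1
  rw [vecInner_comm ((D.eval s').mulVec h), vecInner_comm s' s] at h1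
  linarith

/-- Combining separates the symbols of an orthogonal design. -/
lemma IsOrthogonal.combine_eval {D : STDesign L K K} (hD : D.IsOrthogonal)
    (s : Fin L → ℂ) (h : Fin K → ℂ) :
    D.combine h ((D.eval s).mulVec h) = vecInner h h • s := by
  refine vecInner_left_injective fun z => ?_
  rw [vecInner_combine, hD.vecInner_mulVec, vecInner_smul_right, mul_comm]

lemma IsOrthogonal.vecInner_combine_self_le {D : STDesign L K K} (hD : D.IsOrthogonal)
    (h r : Fin K → ℂ) :
    vecInner (D.combine h r) (D.combine h r) ≤ vecInner h h * vecInner r r := by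
  set w := D.combine h r with hw
  have h1 : vecInner w w ^ 2 ≤ vecInner w w * (vecInner h h * vecInner r r) := by
    calc vecInner w w ^ 2 = vecInner ((D.eval w).mulVec h) r ^ 2 := by
          rw [← vecInner_combine, ← hw]
      _ ≤ _ := (vecInner_sq_le _ _).trans_eq (by rw [hD.vecInner_mulVec_self]; ring)
  rcases (vecInner_self_nonneg w).eq_or_lt with h0 | h0
  · rw [← h0]
    exact mul_nonneg (vecInner_self_nonneg h) (vecInner_self_nonneg r)
  · rw [sq] at h1
    exact le_of_mul_le_mul_left h1 h0

/-- The combined Gaussian noise has mean energy `‖h‖²` per symbol, and its inner products with fixed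
vectors are centred. -/
lemma IsOrthogonal.integral_vecInner_combine {D : STDesign L K K} (hD : D.IsOrthogonal)
    (h : Fin K → ℂ) {m : ℕ} (k : Fin m) :
    (∀ s, HasCenteredVariance (gaussianArray K m)
      (fun n => vecInner s (D.combine h fun t => n t k)) (vecInner s s * vecInner h h / 2)) ∧
    Integrable (fun n : CArray K m => vecInner (D.combine h fun t => n t k)
      (D.combine h fun t => n t k)) (gaussianArray K m) ∧
    ∫ n : CArray K m, vecInner (D.combine h fun t => n t k) (D.combine h fun t => n t k)
      ∂(gaussianArray K m) = L * vecInner h h := by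
  have h1 : ∀ s, HasCenteredVariance (gaussianArray K m)
      (fun n => vecInner s (D.combine h fun t => n t k)) (vecInner s s * vecInner h h / 2) := by
    intro s
    let a : CArray K m := fun t => Pi.single k ((D.eval s).mulVec h t)
    have e1 : ∀ n : CArray K m, arrayInner a n = vecInner s (D.combine h fun t => n t k) := by
      intro n
      rw [vecInner_combine]
      simp only [arrayInner, a, vecInner_single]
      rfl
    have e2 : arrayInner a a = vecInner s s * vecInner h h := by
      rw [e1, vecInner_combine, ← hD.vecInner_mulVec_self]
      simp [a]
    have := hasCenteredVariance_arrayInner a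
    rwa [e2, show arrayInner a = _ from funext e1] at this
  have h2 : ∀ x : Fin L → ℂ, vecInner x x =
      ∑ l, (vecInner (Pi.single l 1) x ^ 2 + vecInner (Pi.single l Complex.I) x ^ 2) := by
    intro x
    simp only [vecInner_self, vecInner_single]
    refine Finset.sum_congr rfl fun l _ => ?_
    simp [Complex.sq_norm, Complex.normSq_apply]
    ring
  have h3 : ∀ l : Fin L, ∀ a : ℂ, ‖a‖ = 1 →
      vecInner (Pi.single l a : Fin L → ℂ) (Pi.single l a) = 1 := by
    intro l a ha
    rw [vecInner_single, Pi.single_eq_same, ← Complex.normSq_eq_conj_mul_self,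
      Complex.ofReal_re, Complex.normSq_eq_norm_sq, ha, one_pow]
  have h4 : ∀ l : Fin L, Integrable (fun n : CArray K m =>
      vecInner (Pi.single l 1) (D.combine h fun t => n t k) ^ 2 +
        vecInner (Pi.single l Complex.I) (D.combine h fun t => n t k) ^ 2) (gaussianArray K m) :=
    fun l => (h1 _).memLp.integrable_sq.add (h1 _).memLp.integrable_sq
  refine ⟨h1, ?_, ?_⟩
  · simp_rw [h2 (D.combine h _)]
    exact integrable_finsetSum _ fun l _ => h4 l
  · simp_rw [h2 (D.combine h _)]
    rw [integral_finsetSum _ fun l _ => h4 l]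
    have : ∀ l : Fin L, ∫ n : CArray K m,
      (vecInner (Pi.single l 1) (D.combine h fun t => n t k) ^ 2 +
        vecInner (Pi.single l Complex.I) (D.combine h fun t => n t k) ^ 2) ∂(gaussianArray K m) =
        vecInner h h := by
      intro l
      rw [integral_add (h1 _).memLp.integrable_sq (h1 _).memLp.integrable_sq, (h1 _).integral_sq,
        (h1 _).integral_sq, h3 l 1 (by simp), h3 l Complex.I (by simp)]
      ring
    simp [this]

end STDesign

namespace COSTBC

variable {M₀ M₁ L : ℕ} (c : COSTBC M₀ M₁ L)

lemma relayDesign_eval_apply {M : ℕ} (A B : Fin M → Matrix (Fin M) (Fin L) ℂ) (s : Fin L → ℂ)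
    (t k : Fin M) : (relayDesign A B).eval s t k =
      (A k).mulVec s t + (B k).mulVec (fun l => conj (s l)) t := by
  simp only [STDesign.eval, relayDesign, Matrix.sum_apply, Matrix.add_apply, Matrix.smul_apply,
    Matrix.of_apply, smul_eq_mul, Matrix.mulVec, dotProduct, ← Finset.sum_add_distrib]
  exact Finset.sum_congr rfl fun _ _ => by ring

/-- The linear processing of a relay preserves the energy. -/
lemma sum_norm_sq_relay (k : Fin M₁) (r : Fin L → ℂ) :
    ∑ t, ‖(c.A k).mulVec r t + (c.B k).mulVec (fun l => conj (r l)) t‖ ^ 2 =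
      vecInner r r := by
  have h := c.relay_orthogonal.vecInner_mulVec_self r (Pi.single k 1)
  rw [vecInner_single, vecInner_self ((STDesign.eval _ _).mulVec _)] at h
  simpa [Matrix.mulVec_single_one, relayDesign_eval_apply] using h

lemma trace_source (s : Fin L → ℂ) :
    ((c.S₀.eval s).conjTranspose * c.S₀.eval s).trace.re = M₀ * vecInner s s := by
  rw [c.source_orthogonal.conjTranspose_mul, Matrix.trace_smul, Matrix.trace_one, smul_eq_mul,
    Fintype.card_fin, vecInner_self, ← Complex.ofReal_natCast, ← Complex.ofReal_mul,
    Complex.ofReal_re, mul_comm]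

lemma symbolAverage_const_mul {S : Finset ℂ} (a : ℝ) (f : (Fin L → ℂ) → ℝ) :
    symbolAverage L S (fun s => a * f s) = a * symbolAverage L S f := by
  simp only [symbolAverage, ← Finset.mul_sum, mul_div_assoc]

lemma symbolAverage_normSq (hM₀ : 0 < M₀) :
    symbolAverage L c.constellation (fun s => vecInner s s) = 1 := by
  have h := c.source_normalized
  simp only [trace_source, symbolAverage_const_mul] at h
  have : (M₀ : ℝ) ≠ 0 := by positivity
  exact mul_left_cancel₀ this (by rw [h, mul_one])

lemma symbolAverage_affine (hM₀ : 0 < M₀) (a b : ℝ) :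
    symbolAverage L c.constellation (fun s => a * vecInner s s + b) = a + b := by
  have h := c.symbolAverage_normSq hM₀
  have hcard : ((symbolVectors L c.constellation).card : ℝ) ≠ 0 := by
    intro h0
    rw [symbolAverage, h0, div_zero] at h
    exact zero_ne_one h
  rw [symbolAverage, Finset.sum_add_distrib, add_div, ← Finset.mul_sum, mul_div_assoc]
  rw [symbolAverage] at h
  rw [h, Finset.sum_const, nsmul_eq_mul, mul_div_cancel_left₀ _ hcard, mul_one]

lemma sourcePower_eq (hM₀ : 0 < M₀) {E₀ : ℝ} (hE₀ : 0 ≤ E₀) : c.sourcePower E₀ = E₀ := by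
  have h : ∀ s, (∑ t, ∑ m, ‖(√E₀ : ℂ) * c.S₀.eval s t m‖ ^ 2) / M₀ = E₀ * vecInner s s + 0 := by
    intro s
    have h1 := c.trace_source s
    have h2 : ((c.S₀.eval s).conjTranspose * c.S₀.eval s).trace.re =
        ∑ t, ∑ m, ‖c.S₀.eval s t m‖ ^ 2 := by
      rw [Finset.sum_comm]
      simp only [Matrix.trace, Matrix.diag, Matrix.mul_apply, Matrix.conjTranspose_apply,
        Complex.re_sum, Complex.star_def, ← Complex.normSq_eq_conj_mul_self, Complex.ofReal_re,
        Complex.normSq_eq_norm_sq]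
    have h3 : ∑ t, ∑ m, ‖(√E₀ : ℂ) * c.S₀.eval s t m‖ ^ 2 =
        E₀ * ∑ t, ∑ m, ‖c.S₀.eval s t m‖ ^ 2 := by
      simp only [Finset.mul_sum, norm_mul, mul_pow, Complex.norm_real, Real.norm_eq_abs, sq_abs,
        Real.sq_sqrt hE₀]
    rw [h3, ← h2, h1]
    have : (M₀ : ℝ) ≠ 0 := by positivity
    field_simp
    ring
  simp only [sourcePower, h]
  rw [c.symbolAverage_affine hM₀, add_zero]

/-- The normalized combined noise of relay `k`. -/
def relayNoise (h : CArray M₀ M₁) (n : CArray M₀ M₁) (k : Fin M₁) : Fin L → ℂ :=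
  (√(vecInner (fun m => h m k) fun m => h m k))⁻¹ •
    c.S₀.combine (fun m => h m k) (fun t => n t k)

/-- The processed signal of a relay is the scaled symbol vector plus noise. When `h_k = 0` both
sides are zero, by the convention `x / 0 = 0`. -/
lemma relaySymbols_eq (E₀ : ℝ) (s : Fin L → ℂ) (h n : CArray M₀ M₁) (k : Fin M₁) :
    c.relaySymbols E₀ s h n k =
      (√E₀ * √(vecInner (fun m => h m k) fun m => h m k)) • s + c.relayNoise h n k := by
  have h1 : c.relayRx E₀ s h n k =
      √E₀ • (c.S₀.eval s).mulVec (fun m => h m k) + fun t => n t k := by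
    ext t
    simp [relayRx]
  ext l
  rw [relaySymbols, h1, STDesign.combine_add, STDesign.combine_smul,
    c.source_orthogonal.combine_eval, ← vecInner_self]
  set H := vecInner (fun m => h m k) fun m => h m k
  have h2 : √H = H / √H := Real.div_sqrt.symm
  have h3 : (√E₀ * √H) • s = (√H)⁻¹ • (√E₀ • H • s) := by
    rw [smul_smul, smul_smul]
    congr 1
    nth_rw 1 [h2]
    ring
  rw [h3, relayNoise]
  simp only [Pi.add_apply, Pi.smul_apply, Complex.real_smul, Complex.ofReal_inv]
  ring

lemma vecInner_relayNoise_le (h n : CArray M₀ M₁) (k : Fin M₁) :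
    vecInner (c.relayNoise h n k) (c.relayNoise h n k) ≤
      vecInner (fun t => n t k) (fun t => n t k) := by
  rw [relayNoise, vecInner_smul_left, vecInner_smul_right, ← mul_assoc, ← mul_inv,
    Real.mul_self_sqrt (vecInner_self_nonneg _)]
  have h1 := c.source_orthogonal.vecInner_combine_self_le (fun m => h m k) (fun t => n t k)
  rcases (vecInner_self_nonneg (fun m => h m k)).eq_or_lt with h0 | h0
  · rw [← h0, inv_zero, zero_mul]
    exact vecInner_self_nonneg _
  · rwa [inv_mul_le_iff₀ h0]

lemma measurable_relaySymbols (E₀ : ℝ) (s : Fin L → ℂ) (k : Fin M₁) (l : Fin L) :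
    Measurable fun ω : CArray M₀ M₁ × CArray M₀ M₁ => c.relaySymbols E₀ s ω.1 ω.2 k l := by
  simp only [relaySymbols, STDesign.combine, relayRx, Matrix.mulVec, dotProduct]
  fun_prop

lemma integral_column_normSq (k : Fin M₁) :
    Integrable (fun h : CArray M₀ M₁ => vecInner (fun m => h m k) fun m => h m k)
      (gaussianArray M₀ M₁) ∧
    ∫ h : CArray M₀ M₁, vecInner (fun m => h m k) (fun m => h m k) ∂(gaussianArray M₀ M₁) = M₀ := by
  have hmp := fun m : Fin M₀ => measurePreserving_gaussianArray_apply m k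
  have hi : ∀ m : Fin M₀, Integrable (fun h : CArray M₀ M₁ => ‖h m k‖ ^ 2)
      (gaussianArray M₀ M₁) := fun m =>
    (hmp m).integrable_comp_of_integrable integral_complexGaussian_normSq.2
  simp only [vecInner_self]
  refine ⟨integrable_finsetSum _ fun m _ => hi m, ?_⟩
  rw [integral_finsetSum _ fun m _ => hi m]
  have : ∀ m : Fin M₀, ∫ h : CArray M₀ M₁, ‖h m k‖ ^ 2 ∂(gaussianArray M₀ M₁) = 1 := fun m => by
    rw [← integral_complexGaussian_normSq.1, ← (hmp m).map_eq,
      integral_map (hmp m).measurable.aemeasurable (by fun_prop)]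
  simp [this]

lemma relayEnergy_eq (hM₀ : 0 < M₀) {E₀ : ℝ} (hE₀ : 0 ≤ E₀) (k : Fin M₁) :
    c.relayEnergy E₀ k = E₀ * M₀ + L := by
  have h1 : ∀ s, ∫ ω : CArray M₀ M₁ × CArray M₀ M₁, ∑ l, ‖c.relaySymbols E₀ s ω.1 ω.2 k l‖ ^ 2
      ∂((gaussianArray M₀ M₁).prod (gaussianArray M₀ M₁)) = E₀ * M₀ * vecInner s s + L := by
    intro s
    simp only [← vecInner_self]
    have hm : Measurable fun ω : CArray M₀ M₁ × CArray M₀ M₁ =>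
        vecInner (c.relaySymbols E₀ s ω.1 ω.2 k) (c.relaySymbols E₀ s ω.1 ω.2 k) := by
      have := c.measurable_relaySymbols E₀ s k
      simp only [vecInner_self]
      fun_prop
    have key : ∀ h : CArray M₀ M₁, (∀ m k, h m k ≠ 0) →
        Integrable (fun n => vecInner (c.relaySymbols E₀ s h n k) (c.relaySymbols E₀ s h n k))
          (gaussianArray M₀ M₁) ∧
        ∫ n, vecInner (c.relaySymbols E₀ s h n k) (c.relaySymbols E₀ s h n k)
          ∂(gaussianArray M₀ M₁) =
            E₀ * vecInner s s * vecInner (fun m => h m k) (fun m => h m k) + L := by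
      intro h hh
      obtain ⟨a1, a2, a3⟩ := c.source_orthogonal.integral_vecInner_combine (fun m => h m k) k
      have hpos : 0 < vecInner (fun m => h m k) (fun m => h m k) := by
        refine (vecInner_self_nonneg _).lt_of_ne fun h0 => ?_
        exact hh ⟨0, hM₀⟩ k (congrFun (vecInner_self_eq_zero.1 h0.symm) ⟨0, hM₀⟩)
      set H := vecInner (fun m => h m k) (fun m => h m k)
      have e : ∀ n, vecInner (c.relaySymbols E₀ s h n k) (c.relaySymbols E₀ s h n k) =
          E₀ * vecInner s s * H + (2 * √E₀ * vecInner s (c.S₀.combine (fun m => h m k)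
            fun t => n t k) + H⁻¹ * vecInner (c.S₀.combine (fun m => h m k) fun t => n t k)
            (c.S₀.combine (fun m => h m k) fun t => n t k)) := by
        intro n
        have hr : c.relaySymbols E₀ s h n k = (√E₀ * √H) • s + (√H)⁻¹ •
            c.S₀.combine (fun m => h m k) fun t => n t k := c.relaySymbols_eq E₀ s h n k
        rw [hr]
        generalize c.S₀.combine _ _ = w
        simp only [vecInner_add_left, vecInner_add_right, vecInner_smul_left, vecInner_smul_right]
        rw [vecInner_comm w s]
        have hs : √H * √H = H := Real.mul_self_sqrt hpos.le
        have hs0 : √H * (√H)⁻¹ = 1 := mul_inv_cancel₀ (Real.sqrt_pos.2 hpos).ne'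
        have hs1 : (√H)⁻¹ * (√H)⁻¹ = H⁻¹ := by rw [← mul_inv, hs]
        have hs2 : √E₀ * √E₀ = E₀ := Real.mul_self_sqrt hE₀
        rw [← hs1]
        calc _ = (√E₀ * √E₀) * vecInner s s * (√H * √H) +
              (2 * √E₀ * vecInner s w * (√H * (√H)⁻¹) + (√H)⁻¹ * (√H)⁻¹ * vecInner w w) := by
              ring
          _ = _ := by rw [hs, hs0, hs2, mul_one]
      simp_rw [e]
      have i1 := (((a1 s).memLp.integrable one_le_two).const_mul (2 * √E₀))
      have i2 := a2.const_mul H⁻¹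
      have i3 : Integrable (fun n : CArray M₀ M₁ => 2 * √E₀ * vecInner s
          (c.S₀.combine (fun m => h m k) fun t => n t k) + H⁻¹ *
          vecInner (c.S₀.combine (fun m => h m k) fun t => n t k)
            (c.S₀.combine (fun m => h m k) fun t => n t k)) (gaussianArray M₀ M₁) := i1.add i2
      refine ⟨(integrable_const _).add i3, ?_⟩
      rw [integral_add (integrable_const _) i3, integral_add i1 i2, integral_const,
        probReal_univ, integral_const_mul, integral_const_mul, (a1 s).integral_eq, a3, one_smul]
      field_simp
      ring
    obtain ⟨b1, b2⟩ := integral_column_normSq (M₀ := M₀) k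
    have hae : ∀ᵐ h ∂(gaussianArray M₀ M₁),
        ∫ n, vecInner (c.relaySymbols E₀ s h n k) (c.relaySymbols E₀ s h n k)
          ∂(gaussianArray M₀ M₁) =
            E₀ * vecInner s s * vecInner (fun m => h m k) (fun m => h m k) + L := by
      filter_upwards [gaussianArray_ae_ne_zero M₀ M₁] with h hh using (key h hh).2
    have hint : Integrable (fun h : CArray M₀ M₁ =>
        E₀ * vecInner s s * vecInner (fun m => h m k) (fun m => h m k) + L)
        (gaussianArray M₀ M₁) := (b1.const_mul _).add (integrable_const _)
    have hI : Integrable (fun ω : CArray M₀ M₁ × CArray M₀ M₁ =>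
        vecInner (c.relaySymbols E₀ s ω.1 ω.2 k) (c.relaySymbols E₀ s ω.1 ω.2 k))
        ((gaussianArray M₀ M₁).prod (gaussianArray M₀ M₁)) := by
      rw [integrable_prod_iff hm.aestronglyMeasurable]
      constructor
      · filter_upwards [gaussianArray_ae_ne_zero M₀ M₁] with h hh using (key h hh).1
      · simp only [Real.norm_eq_abs, abs_of_nonneg (vecInner_self_nonneg _)]
        exact hint.congr (hae.mono fun _ h => h.symm)
    rw [integral_prod _ hI, integral_congr_ae hae, integral_add (b1.const_mul _)
      (integrable_const _), integral_const_mul, b2, integral_const, probReal_univ]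
    simp only [smul_eq_mul]
    ring
  simp only [relayEnergy, h1, c.symbolAverage_affine hM₀]

lemma sum_norm_sq_relayTx {E₀ E₁ : ℝ} (s : Fin L → ℂ)
    (h n : CArray M₀ M₁) (k : Fin M₁) :
    ∑ t, ‖c.relayTx E₀ E₁ s h n k t‖ ^ 2 = (√(E₁ * M₁ / c.relayEnergy E₀ k)) ^ 2 *
      ∑ l, ‖c.relaySymbols E₀ s h n k l‖ ^ 2 := by
  rw [← vecInner_self (c.relaySymbols E₀ s h n k), ← c.sum_norm_sq_relay k, Finset.mul_sum]
  refine Finset.sum_congr rfl fun t _ => ?_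
  rw [relayTx, norm_mul, mul_pow, Complex.norm_real, Real.norm_eq_abs, sq_abs]

lemma relayPower_eq (hM₀ : 0 < M₀) (hM₁ : 0 < M₁) {E₀ E₁ : ℝ} (hE₀ : 0 < E₀) (hE₁ : 0 ≤ E₁)
    (k : Fin M₁) : c.relayPower E₀ E₁ k = E₁ := by
  have hpos : 0 < c.relayEnergy E₀ k := by
    rw [c.relayEnergy_eq hM₀ hE₀.le]; positivity
  have h1 : c.relayPower E₀ E₁ k = E₁ * M₁ / c.relayEnergy E₀ k / M₁ * c.relayEnergy E₀ k := by
    rw [relayPower]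
    simp only [c.sum_norm_sq_relayTx]
    rw [Real.sq_sqrt (by positivity)]
    generalize E₁ * M₁ / c.relayEnergy E₀ k = a
    rw [relayEnergy, ← symbolAverage_const_mul]
    congr 1
    ext s
    rw [← integral_const_mul]
    refine integral_congr_ae (ae_of_all _ fun ω => ?_)
    ring
  rw [h1]
  have : (M₁ : ℝ) ≠ 0 := by positivity
  field_simp

end COSTBC

/-! ### The error probability for given channels -/

/-- The energy of the gains from the source to relay `k`. -/
def columnEnergy {m n : ℕ} (h : CArray m n) (k : Fin n) : ℝ :=
  vecInner (fun m => h m k) fun m => h m k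

/-- The energy of the gains from relay `k` to the destination. -/
def rowEnergy {m n : ℕ} (g : CArray m n) (k : Fin m) : ℝ := vecInner (g k) (g k)

lemma columnEnergy_nonneg {m n : ℕ} (h : CArray m n) (k : Fin n) : 0 ≤ columnEnergy h k :=
  vecInner_self_nonneg _

lemma rowEnergy_nonneg {m n : ℕ} (g : CArray m n) (k : Fin m) : 0 ≤ rowEnergy g k :=
  vecInner_self_nonneg _

namespace COSTBC

variable {M₀ M₁ M₂ L : ℕ} (c : COSTBC M₀ M₁ L)

/-- The array received at the destination when relay `k` has the processed block `r k` and amplifies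
by `β`. -/
def relayMap (β : ℝ) (g : CArray M₁ M₂) : CArray M₁ L →ₗ[ℝ] CArray M₁ M₂ where
  toFun r t i := ∑ k, (β : ℂ) *
    ((c.A k).mulVec (r k) t + (c.B k).mulVec (fun l => conj (r k l)) t) * g k i
  map_add' r r' := by
    ext t i
    simp only [Pi.add_apply, map_add, ← Finset.sum_add_distrib, Matrix.mulVec, dotProduct,
      mul_add]
    exact Finset.sum_congr rfl fun _ _ => by
      simp only [Finset.sum_add_distrib]
      ring
  map_smul' a r := by
    ext t i
    simp only [Pi.smul_apply, Complex.real_smul, map_mul, Complex.conj_ofReal, Matrix.mulVec,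
      dotProduct, Finset.mul_sum, RingHom.id_apply, mul_left_comm _ (a : ℂ)]
    exact Finset.sum_congr rfl fun _ _ => by
      simp only [← Finset.mul_sum]
      ring

/-- `relayNoise` as a real-linear map of the noise received at the relays. -/
def relayNoiseMap (h : CArray M₀ M₁) : CArray M₀ M₁ →ₗ[ℝ] CArray M₁ L where
  toFun n k := c.relayNoise h n k
  map_add' n n' := by
    ext k l
    simp only [relayNoise, Pi.add_apply, Pi.smul_apply]
    rw [← smul_add, ← Pi.add_apply, ← STDesign.combine_add]
    rfl
  map_smul' a n := by
    ext k : 1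
    change _ = a • c.relayNoise h n k
    rw [relayNoise, relayNoise, show (fun t => (a • n) t k) = a • fun t => n t k from rfl,
      STDesign.combine_smul, smul_comm]

lemma arrayInner_relayNoiseMap_le (h n : CArray M₀ M₁) :
    arrayInner (c.relayNoiseMap h n) (c.relayNoiseMap h n) ≤ arrayInner n n := by
  calc arrayInner (c.relayNoiseMap h n) (c.relayNoiseMap h n)
      ≤ ∑ k, vecInner (fun t => n t k) (fun t => n t k) :=
        Finset.sum_le_sum fun k _ => c.vecInner_relayNoise_le h n k
    _ = arrayInner n n := by
        simp only [arrayInner_self, vecInner_self]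
        exact Finset.sum_comm

lemma arrayInner_relayMap_le (β : ℝ) (g : CArray M₁ M₂) (r : CArray M₁ L) :
    arrayInner (c.relayMap β g r) (c.relayMap β g r) ≤
      β ^ 2 * (∑ k, rowEnergy g k) * arrayInner r r := by
  let v : Fin M₁ → Fin M₁ → ℂ := fun t k =>
    (c.A k).mulVec (r k) t + (c.B k).mulVec (fun l => conj (r k l)) t
  have h1 : ∀ t i, ‖c.relayMap β g r t i‖ ^ 2 ≤
      β ^ 2 * ((∑ k, ‖v t k‖ ^ 2) * ∑ k, ‖g k i‖ ^ 2) := by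
    intro t i
    have e : c.relayMap β g r t i = (β : ℂ) * ∑ k, v t k * g k i := by
      simp only [relayMap, LinearMap.coe_mk, AddHom.coe_mk, Finset.mul_sum, v, mul_assoc]
    rw [e, norm_mul, mul_pow, Complex.norm_real, Real.norm_eq_abs, sq_abs]
    gcongr
    calc ‖∑ k, v t k * g k i‖ ^ 2 ≤ (∑ k, ‖v t k‖ * ‖g k i‖) ^ 2 := by
          gcongr
          refine (norm_sum_le _ _).trans_eq ?_
          simp only [norm_mul]
      _ ≤ _ := Finset.sum_mul_sq_le_sq_mul_sq _ _ _
  calc arrayInner (c.relayMap β g r) (c.relayMap β g r)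
      ≤ ∑ t, ∑ i, β ^ 2 * ((∑ k, ‖v t k‖ ^ 2) * ∑ k, ‖g k i‖ ^ 2) := by
        rw [arrayInner_self]
        exact Finset.sum_le_sum fun t _ => Finset.sum_le_sum fun i _ => h1 t i
    _ = β ^ 2 * (∑ i, ∑ k, ‖g k i‖ ^ 2) * ∑ t, ∑ k, ‖v t k‖ ^ 2 := by
        simp only [← Finset.mul_sum, ← Finset.sum_mul]
        ring
    _ = _ := by
        have e1 : ∑ t, ∑ k, ‖v t k‖ ^ 2 = arrayInner r r := by
          rw [Finset.sum_comm]
          exact Finset.sum_congr rfl fun k _ => c.sum_norm_sq_relay k (r k)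
        have e2 : ∑ i, ∑ k, ‖g k i‖ ^ 2 = ∑ k, rowEnergy g k := by
          rw [Finset.sum_comm]
          simp only [rowEnergy, vecInner_self]
        rw [e1, e2]

lemma arrayInner_relayMap_smul (β : ℝ) (g : CArray M₁ M₂) (α : Fin M₁ → ℝ) (s : Fin L → ℂ) :
    arrayInner (c.relayMap β g fun k => α k • s) (c.relayMap β g fun k => α k • s) =
      β ^ 2 * vecInner s s * ∑ k, α k ^ 2 * rowEnergy g k := by
  have e : ∀ t i, c.relayMap β g (fun k => α k • s) t i =
      ((relayDesign c.A c.B).eval s).mulVec (fun k => ((β * α k : ℝ) : ℂ) * g k i) t := by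
    intro t i
    simp only [relayMap, LinearMap.coe_mk, AddHom.coe_mk]
    rw [Matrix.mulVec, dotProduct]
    refine Finset.sum_congr rfl fun k _ => ?_
    rw [relayDesign_eval_apply]
    have e1 : (fun l => conj ((α k • s) l)) = α k • fun l => conj (s l) := by
      ext l; simp
    rw [e1, Matrix.mulVec_smul, Matrix.mulVec_smul]
    simp only [Pi.smul_apply, Complex.real_smul, Complex.ofReal_mul]
    ring
  rw [arrayInner_self, Finset.sum_comm]
  simp only [e, ← vecInner_self]
  simp_rw [c.relay_orthogonal.vecInner_mulVec_self]
  simp only [vecInner_self _, norm_mul, mul_pow, Complex.norm_real, Real.norm_eq_abs, sq_abs,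
    rowEnergy]
  rw [← Finset.mul_sum, Finset.sum_comm, mul_comm (β ^ 2), mul_assoc]
  simp only [Finset.mul_sum, mul_assoc]

/-- The amplification factor of the relays. -/
def relayGain (_ : COSTBC M₀ M₁ L) (E₀ E₁ : ℝ) : ℝ := √(E₁ * M₁ / (E₀ * M₀ + L))

/-- The noiseless array received at the destination. -/
def meanSignal (E₀ E₁ : ℝ) (s : Fin L → ℂ) (h : CArray M₀ M₁) (g : CArray M₁ M₂) : CArray M₁ M₂ :=
  c.relayMap (c.relayGain E₀ E₁) g fun k => (√E₀ * √(columnEnergy h k)) • s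

/-- The real-linear map from the relay noise to its contribution at the destination. -/
def relayedNoiseMap (E₀ E₁ : ℝ) (h : CArray M₀ M₁) (g : CArray M₁ M₂) :
    CArray M₀ M₁ →ₗ[ℝ] CArray M₁ M₂ :=
  c.relayMap (c.relayGain E₀ E₁) g ∘ₗ c.relayNoiseMap h

lemma relayedSignal_eq (hM₀ : 0 < M₀) {E₀ : ℝ} (hE₀ : 0 ≤ E₀) (E₁ : ℝ) (s : Fin L → ℂ)
    (h : CArray M₀ M₁) (g : CArray M₁ M₂) (n : CArray M₀ M₁) :
    c.relayedSignal E₀ E₁ s h g n =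
      c.meanSignal E₀ E₁ s h g + c.relayedNoiseMap E₀ E₁ h g n := by
  have h1 : c.relayedSignal E₀ E₁ s h g n =
      c.relayMap (c.relayGain E₀ E₁) g (fun k => c.relaySymbols E₀ s h n k) := by
    ext t i
    simp only [relayedSignal, relayTx, c.relayEnergy_eq hM₀ hE₀, relayMap, LinearMap.coe_mk,
      AddHom.coe_mk, relayGain]
  rw [h1, meanSignal, relayedNoiseMap, LinearMap.comp_apply, ← map_add]
  congr 1
  ext k : 1
  exact c.relaySymbols_eq E₀ s h n k

lemma likelihood_eq (hM₀ : 0 < M₀) {E₀ : ℝ} (hE₀ : 0 ≤ E₀) (E₁ : ℝ) (s : Fin L → ℂ)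
    (h : CArray M₀ M₁) (g y : CArray M₁ M₂) :
    c.likelihood E₀ E₁ s h g y = noiseDensity (Real.pi ^ (M₁ * M₂))⁻¹
      (c.relayedNoiseMap E₀ E₁ h g) (y - c.meanSignal E₀ E₁ s h g) := by
  simp only [likelihood, noiseDensity, arrayInner_self, c.relayedSignal_eq hM₀ hE₀, Pi.sub_apply,
    Pi.add_apply, sub_add_eq_sub_sub]

/-- The squared distance at the destination of the noiseless arrays of two symbol vectors. -/
lemma arrayInner_meanSignal_sub {E₀ E₁ : ℝ} (hE₀ : 0 ≤ E₀) (s s' : Fin L → ℂ)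
    (h : CArray M₀ M₁) (g : CArray M₁ M₂) :
    arrayInner (c.meanSignal E₀ E₁ s h g - c.meanSignal E₀ E₁ s' h g)
      (c.meanSignal E₀ E₁ s h g - c.meanSignal E₀ E₁ s' h g) =
    c.relayGain E₀ E₁ ^ 2 * vecInner (s - s') (s - s') *
      (E₀ * ∑ k, columnEnergy h k * rowEnergy g k) := by
  have e : c.meanSignal E₀ E₁ s h g - c.meanSignal E₀ E₁ s' h g =
      c.relayMap (c.relayGain E₀ E₁) g
        fun k => (√E₀ * √(columnEnergy h k)) • (s - s') := by
    rw [meanSignal, meanSignal, ← map_sub]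
    congr 1
    ext k : 1
    exact (smul_sub _ _ _).symm
  rw [e, arrayInner_relayMap_smul]
  simp only [mul_pow, Real.sq_sqrt hE₀, Real.sq_sqrt (columnEnergy_nonneg h _), Finset.mul_sum,
    mul_assoc]

/-- For given channels, the two likelihoods are those of one Gaussian noise law translated by the two
noiseless arrays, and the error probability lies between two exponentials. -/
lemma conditional_error_bounds (hM₀ : 0 < M₀) {E₀ E₁ : ℝ} (hE₀ : 0 ≤ E₀)
    (s s' : Fin L → ℂ) (h : CArray M₀ M₁) (g : CArray M₁ M₂) :
    ((gaussianArray M₀ M₁).prod (gaussianArray M₁ M₂)) {p |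
      c.likelihood E₀ E₁ s h g (c.received E₀ E₁ s h g p.1 p.2) ≤
        c.likelihood E₀ E₁ s' h g (c.received E₀ E₁ s h g p.1 p.2)} ≤
      ENNReal.ofReal (Real.exp (-(c.relayGain E₀ E₁ ^ 2 * vecInner (s - s') (s - s') *
        (E₀ * ∑ k, columnEnergy h k * rowEnergy g k) /
          (1 + c.relayGain E₀ E₁ ^ 2 * ∑ k, rowEnergy g k) / 4))) ∧
    ENNReal.ofReal (1 / 4 * Real.exp (-(c.relayGain E₀ E₁ ^ 2 * vecInner (s - s') (s - s') *
        (E₀ * ∑ k, columnEnergy h k * rowEnergy g k) / 2))) ≤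
    ((gaussianArray M₀ M₁).prod (gaussianArray M₁ M₂)) {p |
      c.likelihood E₀ E₁ s h g (c.received E₀ E₁ s h g p.1 p.2) ≤
        c.likelihood E₀ E₁ s' h g (c.received E₀ E₁ s h g p.1 p.2)} := by
  set N := c.relayedNoiseMap E₀ E₁ h g with hN
  set δ := c.meanSignal E₀ E₁ s h g - c.meanSignal E₀ E₁ s' h g with hδ
  set β := c.relayGain E₀ E₁
  obtain ⟨u, a, ha, hu⟩ := exists_add_map_transpose_eq N δ
  have hset : {p : CArray M₀ M₁ × CArray M₁ M₂ |
      c.likelihood E₀ E₁ s h g (c.received E₀ E₁ s h g p.1 p.2) ≤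
        c.likelihood E₀ E₁ s' h g (c.received E₀ E₁ s h g p.1 p.2)} =
      {p | 2 * jointFunctional a u p + (arrayInner a a + arrayInner u u) ≤ 0} := by
    rw [← setOf_noiseDensity_le_eq (C := (Real.pi ^ (M₁ * M₂))⁻¹) (by positivity) ha hu]
    ext p
    have e1 : c.received E₀ E₁ s h g p.1 p.2 = c.meanSignal E₀ E₁ s h g + N p.1 + p.2 := by
      rw [hN, ← c.relayedSignal_eq hM₀ hE₀]
      rfl
    have e2 : c.meanSignal E₀ E₁ s h g + N p.1 + p.2 - c.meanSignal E₀ E₁ s h g =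
      N p.1 + p.2 := by abel
    have e3 : c.meanSignal E₀ E₁ s h g + N p.1 + p.2 - c.meanSignal E₀ E₁ s' h g =
      N p.1 + p.2 + δ := by rw [hδ]; abel
    simp only [Set.mem_ofPred_eq, c.likelihood_eq hM₀ hE₀, e1, ← hN, e2, e3]
  have hsum : 0 ≤ ∑ k, rowEnergy g k := Finset.sum_nonneg fun k _ => rowEnergy_nonneg g k
  have hNle : ∀ x, arrayInner (N x) (N x) ≤ β ^ 2 * (∑ k, rowEnergy g k) * arrayInner x x := by
    intro x
    refine (c.arrayInner_relayMap_le β g (c.relayNoiseMap h x)).trans ?_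
    gcongr
    exact c.arrayInner_relayNoiseMap_le h x
  have hν : 0 ≤ β ^ 2 * ∑ k, rowEnergy g k := by positivity
  have b1 := arrayInner_le_of_add_map_eq hu hν hNle
  have b2 := le_arrayInner_of_add_map_eq ha hu
  rw [hδ, c.arrayInner_meanSignal_sub hE₀] at b1 b2
  rw [hset]
  constructor
  · refine (measure_jointFunctional_le a u rfl).trans (ENNReal.ofReal_le_ofReal ?_)
    rw [Real.exp_le_exp]
    have := (div_le_iff₀' (by positivity : 0 < 1 + β ^ 2 * ∑ k, rowEnergy g k)).2 b1
    linarith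
  · refine le_trans (ENNReal.ofReal_le_ofReal ?_) (le_measure_jointFunctional a u rfl)
    gcongr

lemma measurable_relayedSignal (E₀ E₁ : ℝ) (s : Fin L → ℂ) (t : Fin M₁) (i : Fin M₂) :
    Measurable fun ω : CArray M₀ M₁ × CArray M₁ M₂ × CArray M₀ M₁ =>
      c.relayedSignal E₀ E₁ s ω.1 ω.2.1 ω.2.2 t i := by
  have h1 : ∀ k l, Measurable fun ω : CArray M₀ M₁ × CArray M₁ M₂ × CArray M₀ M₁ =>
      c.relaySymbols E₀ s ω.1 ω.2.2 k l := by
    intro k l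
    have hφ : Measurable fun ω : CArray M₀ M₁ × CArray M₁ M₂ × CArray M₀ M₁ =>
      (ω.1, ω.2.2) := by fun_prop
    simpa only [Function.comp_def] using (c.measurable_relaySymbols E₀ s k l).comp hφ
  simp only [relayedSignal, relayTx, Matrix.mulVec, dotProduct]
  fun_prop

lemma measurable_likelihood (E₀ E₁ : ℝ) (s : Fin L → ℂ) :
    Measurable fun ω : CArray M₀ M₁ × CArray M₁ M₂ × CArray M₁ M₂ =>
      c.likelihood E₀ E₁ s ω.1 ω.2.1 ω.2.2 := by
  have h1 : ∀ t i, Measurable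
      fun p : (CArray M₀ M₁ × CArray M₁ M₂ × CArray M₁ M₂) × CArray M₀ M₁ =>
        c.relayedSignal E₀ E₁ s p.1.1 p.1.2.1 p.2 t i := by
    intro t i
    have hφ : Measurable fun p : (CArray M₀ M₁ × CArray M₁ M₂ × CArray M₁ M₂) × CArray M₀ M₁ =>
      (p.1.1, p.1.2.1, p.2) := by fun_prop
    simpa only [Function.comp_def] using (c.measurable_relayedSignal E₀ E₁ s t i).comp hφ
  refine StronglyMeasurable.measurable ?_
  unfold likelihood
  refine StronglyMeasurable.integral_prod_right (f := fun
    (ω : CArray M₀ M₁ × CArray M₁ M₂ × CArray M₁ M₂) (n : CArray M₀ M₁) =>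
      (Real.pi ^ (M₁ * M₂))⁻¹ * Real.exp
        (-∑ t, ∑ i, ‖ω.2.2 t i - c.relayedSignal E₀ E₁ s ω.1 ω.2.1 n t i‖ ^ 2)) ?_
  refine Measurable.stronglyMeasurable ?_
  simp only [Function.uncurry_def]
  fun_prop

lemma measurableSet_error (E₀ E₁ : ℝ) (s s' : Fin L → ℂ) :
    MeasurableSet {ω : CArray M₀ M₁ × CArray M₁ M₂ × CArray M₀ M₁ × CArray M₁ M₂ |
      c.likelihood E₀ E₁ s ω.1 ω.2.1 (c.received E₀ E₁ s ω.1 ω.2.1 ω.2.2.1 ω.2.2.2) ≤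
        c.likelihood E₀ E₁ s' ω.1 ω.2.1 (c.received E₀ E₁ s ω.1 ω.2.1 ω.2.2.1 ω.2.2.2)} := by
  have h1 : Measurable fun ω : CArray M₀ M₁ × CArray M₁ M₂ × CArray M₀ M₁ × CArray M₁ M₂ =>
      c.received E₀ E₁ s ω.1 ω.2.1 ω.2.2.1 ω.2.2.2 := by
    refine measurable_pi_lambda _ fun t => measurable_pi_lambda _ fun i => ?_
    have hφ : Measurable fun ω : CArray M₀ M₁ × CArray M₁ M₂ × CArray M₀ M₁ × CArray M₁ M₂ =>
      (ω.1, ω.2.1, ω.2.2.1) := by fun_prop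
    have hz : Measurable fun ω : CArray M₀ M₁ × CArray M₁ M₂ × CArray M₀ M₁ × CArray M₁ M₂ =>
      ω.2.2.2 t i := by fun_prop
    have := (c.measurable_relayedSignal (M₂ := M₂) E₀ E₁ s t i).comp hφ
    simp only [Function.comp_def] at this
    exact this.add hz
  have hφ : Measurable fun ω : CArray M₀ M₁ × CArray M₁ M₂ × CArray M₀ M₁ × CArray M₁ M₂ =>
      (ω.1, ω.2.1, c.received E₀ E₁ s ω.1 ω.2.1 ω.2.2.1 ω.2.2.2) := by fun_prop
  have h2 := fun s'' => (c.measurable_likelihood (M₂ := M₂) E₀ E₁ s'').comp hφ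
  simp only [Function.comp_def] at h2
  exact measurableSet_le (h2 s) (h2 s')

/-- The pairwise error probability is the mean over the channels of the conditional one. -/
lemma pairwiseErrorProb_eq (E₀ E₁ : ℝ) (s s' : Fin L → ℂ) :
    c.pairwiseErrorProb M₂ E₀ E₁ s s' = (∫⁻ h, ∫⁻ g,
      ((gaussianArray M₀ M₁).prod (gaussianArray M₁ M₂)) {p |
        c.likelihood E₀ E₁ s h g (c.received E₀ E₁ s h g p.1 p.2) ≤
          c.likelihood E₀ E₁ s' h g (c.received E₀ E₁ s h g p.1 p.2)}
        ∂(gaussianArray M₁ M₂) ∂(gaussianArray M₀ M₁)).toReal := by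
  have hm := c.measurableSet_error (M₂ := M₂) E₀ E₁ s s'
  rw [pairwiseErrorProb, Measure.real, Measure.prod_apply hm]
  congr 1
  refine lintegral_congr fun h => ?_
  rw [Measure.prod_apply (measurable_prodMk_left hm)]
  rfl

end COSTBC

/-! ### Averaging over the channels -/

/-- A power law sandwich, up to an arbitrarily small loss in the exponent of the upper bound,
determines the diversity gain. -/
lemma hasDiversityGain_of_bounds {P : ℝ → ℝ} {d : ℝ} (hd : 0 < d)
    (hlow : ∃ c : ℝ, 0 < c ∧ ∀ E, 1 ≤ E → c * E ^ (-d) ≤ P E)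
    (hup : ∀ b, 0 < b → b < d → ∃ C : ℝ, 0 < C ∧ ∀ E, 1 ≤ E → P E ≤ C * E ^ (-b)) :
    HasDiversityGain P d := by
  obtain ⟨c, hc, hlow⟩ := hlow
  have hlim : ∀ K e : ℝ, Tendsto (fun E => e - K / Real.log E) atTop (𝓝 e) := by
    intro K e
    simpa using (tendsto_const_nhds (x := e)).sub
      (tendsto_const_nhds (x := K) |>.div_atTop Real.tendsto_log_atTop)
  refine tendsto_order.2 ⟨fun b hb => ?_, fun b hb => ?_⟩
  · obtain ⟨b', hb1, hb2⟩ := exists_between (max_lt hb hd)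
    obtain ⟨C, hC, hup⟩ := hup b' ((le_max_right _ _).trans_lt hb1) hb2
    filter_upwards [(hlim (Real.log C) b').eventually_const_lt ((le_max_left _ _).trans_lt hb1),
      eventually_gt_atTop 1] with E h1 hE
    have hE0 : 0 < E := by linarith
    have hlog : 0 < Real.log E := Real.log_pos hE
    refine h1.trans_le ?_
    have hP : 0 < P E := lt_of_lt_of_le (by positivity) (hlow E hE.le)
    have h2 : Real.log (P E) ≤ Real.log C - b' * Real.log E := by
      have := Real.log_le_log hP (hup E hE.le)
      rw [Real.log_mul hC.ne' (by positivity), Real.log_rpow hE0] at this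
      linarith
    rw [← neg_div, le_div_iff₀ hlog, sub_mul, div_mul_cancel₀ _ hlog.ne']
    linarith
  · filter_upwards [(hlim (Real.log c) d).eventually_lt_const hb, eventually_gt_atTop 1]
      with E h1 hE
    have hE0 : 0 < E := by linarith
    have hlog : 0 < Real.log E := Real.log_pos hE
    refine lt_of_le_of_lt ?_ h1
    have h2 : Real.log c - d * Real.log E ≤ Real.log (P E) := by
      have := Real.log_le_log (by positivity) (hlow E hE.le)
      rw [Real.log_mul hc.ne' (by positivity), Real.log_rpow hE0] at this
      linarith
    rw [← neg_div, div_le_iff₀ hlog, sub_mul, div_mul_cancel₀ _ hlog.ne']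
    linarith

lemma exp_neg_le_mul_rpow_neg {a y : ℝ} (ha : 0 < a) (hy : 0 < y) :
    Real.exp (-y) ≤ a ^ a * y ^ (-a) := by
  have h1 : y / a ≤ Real.exp (y / a) := by linarith [Real.add_one_le_exp (y / a)]
  have h2 : (y / a) ^ a ≤ Real.exp y := by
    calc (y / a) ^ a ≤ Real.exp (y / a) ^ a := by gcongr
      _ = Real.exp y := by rw [← Real.exp_mul, div_mul_cancel₀ _ ha.ne']
  rw [Real.div_rpow hy.le ha.le] at h2
  rw [Real.exp_neg, Real.rpow_neg hy.le, inv_le_comm₀ (Real.exp_pos _) (by positivity), mul_inv,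
    inv_inv, mul_comm, ← div_eq_mul_inv]
  exact h2

/-- A negative power of `∑ i, ‖v i‖ ^ 2` is bounded by a product of functions of the single
entries. -/
lemma rpow_neg_vecInner_le {n : ℕ} (hn : 0 < n) {v : Fin n → ℂ} (hv : ∀ i, v i ≠ 0) {a : ℝ}
    (ha : 0 < a) : vecInner v v ^ (-a) ≤ ∏ i, ‖v i‖ ^ (-(2 * a / n)) := by
  have hn' : (n : ℝ) ≠ 0 := by positivity
  calc vecInner v v ^ (-a) = ∏ _i : Fin n, vecInner v v ^ (-(a / n)) := by
        rw [Finset.prod_const, Finset.card_univ, Fintype.card_fin,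
          ← Real.rpow_mul_natCast (vecInner_self_nonneg v)]
        congr 1
        field_simp
    _ ≤ ∏ i, ‖v i‖ ^ (-(2 * a / n)) := by
        refine Finset.prod_le_prod (fun i _ => Real.rpow_nonneg (vecInner_self_nonneg v) _)
          fun i _ => ?_
        have hpos : 0 < ‖v i‖ := norm_pos_iff.2 (hv i)
        have h1 : ‖v i‖ ^ 2 ≤ vecInner v v := by
          rw [vecInner_self]
          exact Finset.single_le_sum (f := fun i => ‖v i‖ ^ 2) (fun _ _ => by positivity)
            (Finset.mem_univ i)
        refine (Real.rpow_le_rpow_of_nonpos (by positivity) h1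
          (neg_nonpos.2 (by positivity))).trans_eq ?_
        rw [← Real.rpow_natCast, ← Real.rpow_mul hpos.le]
        congr 1
        push_cast
        ring

lemma one_add_sum_le_prod {ι : Type*} (s : Finset ι) {f : ι → ℝ} (hf : ∀ i, 0 ≤ f i) :
    1 + ∑ i ∈ s, f i ≤ ∏ i ∈ s, (1 + f i) := by
  classical
  induction s using Finset.induction_on with
  | empty => simp
  | insert i s hi ih =>
    rw [Finset.sum_insert hi, Finset.prod_insert hi]
    have := hf i
    have h2 : 0 ≤ ∑ i ∈ s, f i := Finset.sum_nonneg fun _ _ => hf _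
    nlinarith

/-- The exponential bound on the error probability, dominated by a product of functions of the single
channel gains. -/
lemma exp_neg_channel_le {M₀ M₁ M₂ : ℕ} (hM₀ : 0 < M₀) (hM₂ : 0 < M₂) {a x : ℝ} (ha : 0 < a)
    (hx : 0 < x) {h : CArray M₀ M₁} {g : CArray M₁ M₂} (hh : ∀ m k, h m k ≠ 0)
    (hg : ∀ k i, g k i ≠ 0) :
    Real.exp (-(x * (∑ k, columnEnergy h k * rowEnergy g k) / (1 + ∑ k, rowEnergy g k))) ≤
      (a ^ a * x ^ (-a)) ^ M₁ * ((∏ m, ∏ k, ‖h m k‖ ^ (-(2 * a / M₀))) *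
        ∏ k, ∏ i, (‖g k i‖ ^ (-(2 * a / M₂)) * (1 + ‖g k i‖ ^ 2) ^ (a * M₁))) := by
  have hH : ∀ k, 0 < columnEnergy h k := fun k =>
    (columnEnergy_nonneg h k).lt_of_ne fun h0 =>
      hh ⟨0, hM₀⟩ k (congrFun (vecInner_self_eq_zero.1 h0.symm) ⟨0, hM₀⟩)
  have hG : ∀ k, 0 < rowEnergy g k := fun k =>
    (rowEnergy_nonneg g k).lt_of_ne fun h0 =>
      hg k ⟨0, hM₂⟩ (congrFun (vecInner_self_eq_zero.1 h0.symm) ⟨0, hM₂⟩)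
  set G := 1 + ∑ k, rowEnergy g k with hGdef
  have hGpos : 0 < G := by
    have : 0 ≤ ∑ k, rowEnergy g k := Finset.sum_nonneg fun k _ => rowEnergy_nonneg g k
    linarith
  have hGle : G ≤ ∏ k, ∏ i, (1 + ‖g k i‖ ^ 2) := by
    refine (one_add_sum_le_prod Finset.univ (rowEnergy_nonneg g)).trans ?_
    refine Finset.prod_le_prod (fun k _ => by linarith [rowEnergy_nonneg g k]) fun k _ => ?_
    rw [rowEnergy, vecInner_self]
    exact one_add_sum_le_prod Finset.univ fun i => by positivity
  have h1 : Real.exp (-(x * (∑ k, columnEnergy h k * rowEnergy g k) / G)) =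
      ∏ k, Real.exp (-(x * columnEnergy h k * rowEnergy g k / G)) := by
    rw [← Real.exp_sum, Finset.sum_neg_distrib, Finset.mul_sum, Finset.sum_div]
    simp only [mul_assoc]
  have h2 : ∀ k, Real.exp (-(x * columnEnergy h k * rowEnergy g k / G)) ≤
      (a ^ a * x ^ (-a)) * (columnEnergy h k ^ (-a) * rowEnergy g k ^ (-a)) * G ^ a := by
    intro k
    have hHk := hH k
    have hGk := hG k
    refine (exp_neg_le_mul_rpow_neg ha (by positivity)).trans_eq ?_
    rw [Real.div_rpow (by positivity) hGpos.le, Real.mul_rpow (by positivity) hGk.le,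
      Real.mul_rpow hx.le hHk.le, Real.rpow_neg hGpos.le, div_inv_eq_mul]
    ring
  have h3 : G ^ (a * M₁) ≤ ∏ k, ∏ i, (1 + ‖g k i‖ ^ 2) ^ (a * M₁) := by
    refine (Real.rpow_le_rpow hGpos.le hGle (by positivity)).trans_eq ?_
    rw [← Real.finsetProd_rpow _ _ fun k _ => Finset.prod_nonneg fun i _ => by positivity]
    exact Finset.prod_congr rfl fun k _ =>
      (Real.finsetProd_rpow _ _ (fun i _ => by positivity) _).symm
  have h4 : ∏ k, columnEnergy h k ^ (-a) ≤ ∏ m, ∏ k, ‖h m k‖ ^ (-(2 * a / M₀)) := by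
    rw [Finset.prod_comm]
    exact Finset.prod_le_prod (fun k _ => by have := hH k; positivity) fun k _ =>
      rpow_neg_vecInner_le hM₀ (fun m => hh m k) ha
  have h5 : ∏ k, rowEnergy g k ^ (-a) ≤ ∏ k, ∏ i, ‖g k i‖ ^ (-(2 * a / M₂)) :=
    Finset.prod_le_prod (fun k _ => by have := hG k; positivity) fun k _ =>
      rpow_neg_vecInner_le hM₂ (hg k) ha
  have h6 : 0 ≤ ∏ k, columnEnergy h k ^ (-a) :=
    Finset.prod_nonneg fun k _ => Real.rpow_nonneg (columnEnergy_nonneg h k) _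
  have h7 : 0 ≤ ∏ k, rowEnergy g k ^ (-a) :=
    Finset.prod_nonneg fun k _ => Real.rpow_nonneg (rowEnergy_nonneg g k) _
  rw [h1]
  calc ∏ k, Real.exp (-(x * columnEnergy h k * rowEnergy g k / G))
      ≤ ∏ k, ((a ^ a * x ^ (-a)) * (columnEnergy h k ^ (-a) * rowEnergy g k ^ (-a)) * G ^ a) :=
        Finset.prod_le_prod (fun k _ => (Real.exp_pos _).le) fun k _ => h2 k
    _ = (a ^ a * x ^ (-a)) ^ M₁ * ((∏ k, columnEnergy h k ^ (-a)) *
          ((∏ k, rowEnergy g k ^ (-a)) * G ^ (a * M₁))) := by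
        simp only [Finset.prod_mul_distrib, Finset.prod_const, Finset.card_univ, Fintype.card_fin]
        rw [Real.rpow_mul_natCast hGpos.le]
        ring
    _ ≤ (a ^ a * x ^ (-a)) ^ M₁ * ((∏ m, ∏ k, ‖h m k‖ ^ (-(2 * a / M₀))) *
          ((∏ k, ∏ i, ‖g k i‖ ^ (-(2 * a / M₂))) *
            ∏ k, ∏ i, (1 + ‖g k i‖ ^ 2) ^ (a * M₁))) := by
        gcongr
    _ = _ := by
        simp only [Finset.prod_mul_distrib]

/-- Averaging the exponential bound over the channels costs at most the power `x ^ (-a * M₁)`, for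
every `a` below both `M₀` and `M₂`: the dominating product has a finite mean since the negative
moments that occur have order less than two. -/
lemma lintegral_exp_neg_channel_le {M₀ M₁ M₂ : ℕ} (hM₀ : 0 < M₀) (hM₂ : 0 < M₂) {a : ℝ}
    (ha : 0 < a) (ha₀ : a < M₀) (ha₂ : a < M₂) :
    ∃ C : ℝ, 0 < C ∧ ∀ x : ℝ, 0 < x →
      ∫⁻ h : CArray M₀ M₁, ∫⁻ g : CArray M₁ M₂, ENNReal.ofReal (Real.exp
        (-(x * (∑ k, columnEnergy h k * rowEnergy g k) / (1 + ∑ k, rowEnergy g k))))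
        ∂(gaussianArray M₁ M₂) ∂(gaussianArray M₀ M₁) ≤
      ENNReal.ofReal (C * x ^ (-(a * M₁))) := by
  have hM₀' : (0 : ℝ) < M₀ := by positivity
  have hM₂' : (0 : ℝ) < M₂ := by positivity
  let φ : ℂ → ENNReal := fun z => ENNReal.ofReal (‖z‖ ^ (-(2 * a / M₀)))
  let ψ : ℂ → ENNReal := fun z =>
    ENNReal.ofReal (‖z‖ ^ (-(2 * a / M₂)) * (1 + ‖z‖ ^ 2) ^ (a * M₁))
  have hφm : Measurable φ := by fun_prop
  have hψm : Measurable ψ := by fun_prop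
  have hφ : ∫⁻ z, φ z ∂complexGaussian < ⊤ := by
    have := lintegral_complexGaussian_rpow_lt_top (q := -(2 * a / M₀)) (p := 0)
      (by rw [neg_lt_neg_iff, div_lt_iff₀ hM₀']; linarith) le_rfl
    simpa only [Real.rpow_zero, mul_one] using this
  have hψ : ∫⁻ z, ψ z ∂complexGaussian < ⊤ :=
    lintegral_complexGaussian_rpow_lt_top
      (by rw [neg_lt_neg_iff, div_lt_iff₀ hM₂']; linarith) (by positivity)
  set A := ∫⁻ h : CArray M₀ M₁, ∏ m, ∏ k, φ (h m k) ∂(gaussianArray M₀ M₁) with hA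
  set B := ∫⁻ g : CArray M₁ M₂, ∏ k, ∏ i, ψ (g k i) ∂(gaussianArray M₁ M₂) with hB
  have hAt : A ≠ ⊤ := by
    rw [hA, lintegral_gaussianArray_prod fun _ _ => hφm]
    exact (ENNReal.prod_lt_top fun _ _ => ENNReal.prod_lt_top fun _ _ => hφ).ne
  have hBt : B ≠ ⊤ := by
    rw [hB, lintegral_gaussianArray_prod fun _ _ => hψm]
    exact (ENNReal.prod_lt_top fun _ _ => ENNReal.prod_lt_top fun _ _ => hψ).ne
  refine ⟨(a ^ a) ^ M₁ * ((A * B).toReal + 1), by positivity, fun x hx => ?_⟩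
  have hbm : Measurable fun g : CArray M₁ M₂ => ∏ k, ∏ i, ψ (g k i) :=
    Finset.measurable_prod _ fun k _ => Finset.measurable_prod _ fun i _ =>
      hψm.comp (by fun_prop)
  have ham : Measurable fun h : CArray M₀ M₁ => ∏ m, ∏ k, φ (h m k) :=
    Finset.measurable_prod _ fun k _ => Finset.measurable_prod _ fun i _ =>
      hφm.comp (by fun_prop)
  calc _ ≤ ∫⁻ h : CArray M₀ M₁, ∫⁻ g : CArray M₁ M₂,
        ENNReal.ofReal ((a ^ a * x ^ (-a)) ^ M₁) *
          ((∏ m, ∏ k, φ (h m k)) * ∏ k, ∏ i, ψ (g k i))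
        ∂(gaussianArray M₁ M₂) ∂(gaussianArray M₀ M₁) := by
        refine lintegral_mono_ae ?_
        filter_upwards [gaussianArray_ae_ne_zero M₀ M₁] with h hh
        refine lintegral_mono_ae ?_
        filter_upwards [gaussianArray_ae_ne_zero M₁ M₂] with g hg
        refine (ENNReal.ofReal_le_ofReal
          (exp_neg_channel_le hM₀ hM₂ ha hx hh hg)).trans_eq ?_
        rw [ENNReal.ofReal_mul (by positivity), ENNReal.ofReal_mul (by positivity),
          ENNReal.ofReal_prod_of_nonneg (fun _ _ => by positivity),
          ENNReal.ofReal_prod_of_nonneg (fun _ _ => by positivity)]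
        congr 2
        · exact Finset.prod_congr rfl fun m _ =>
            ENNReal.ofReal_prod_of_nonneg fun _ _ => by positivity
        · exact Finset.prod_congr rfl fun m _ =>
            ENNReal.ofReal_prod_of_nonneg fun _ _ => by positivity
    _ = ENNReal.ofReal ((a ^ a * x ^ (-a)) ^ M₁) * (A * B) := by
        simp_rw [lintegral_const_mul _ (hbm.const_mul _), lintegral_const_mul _ hbm, ← hB]
        rw [lintegral_const_mul _ (ham.mul_const _), lintegral_mul_const _ ham]
    _ ≤ ENNReal.ofReal ((a ^ a * x ^ (-a)) ^ M₁) * ENNReal.ofReal ((A * B).toReal + 1) := by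
        gcongr
        rw [← ENNReal.ofReal_toReal (ENNReal.mul_ne_top hAt hBt)]
        exact ENNReal.ofReal_le_ofReal (by rw [ENNReal.toReal_ofReal ENNReal.toReal_nonneg]; simp)
    _ = _ := by
        rw [← ENNReal.ofReal_mul (by positivity), mul_pow, ← Real.rpow_mul_natCast hx.le]
        congr 1
        rw [neg_mul]
        ring

lemma gaussianArray_ball_ge {m n : ℕ} {r : ℝ} (h0 : 0 ≤ r) (h1 : r ≤ 1) :
    ENNReal.ofReal ((Real.exp (-1) * r ^ 2) ^ (m * n)) ≤
      gaussianArray m n {x | ∀ i j, ‖x i j‖ < r} := by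
  have e : {x : CArray m n | ∀ i j, ‖x i j‖ < r} =
      Set.univ.pi fun _ => Set.univ.pi fun _ => Metric.ball (0 : ℂ) r := by
    ext x; simp
  rw [e, gaussianArray, Measure.pi_pi]
  simp only [Measure.pi_pi, Finset.prod_const, Finset.card_univ, Fintype.card_fin]
  rw [← pow_mul, mul_comm n m, ENNReal.ofReal_pow (by positivity)]
  gcongr
  exact complexGaussian_ball_ge h0 h1

lemma vecInner_self_le {n : ℕ} {v : Fin n → ℂ} {r : ℝ} (hv : ∀ i, ‖v i‖ < r) :
    vecInner v v ≤ n * r ^ 2 := by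
  rw [vecInner_self]
  calc ∑ i, ‖v i‖ ^ 2 ≤ ∑ _i : Fin n, r ^ 2 := by
        gcongr with i
        exact (hv i).le
    _ = n * r ^ 2 := by simp

/-- A lower bound for the averaged exponential, by restriction to gains below `r₀` on the first hop
and below `r₂` on the second. -/
lemma le_lintegral_exp_neg_channel {M₀ M₁ M₂ : ℕ} {y r₀ r₂ : ℝ} (hy : 0 ≤ y) (h₀ : 0 ≤ r₀)
    (h₀' : r₀ ≤ 1) (h₂ : 0 ≤ r₂) (h₂' : r₂ ≤ 1) :
    ENNReal.ofReal (1 / 4 * Real.exp (-(y * (M₁ * (M₀ * r₀ ^ 2 * (M₂ * r₂ ^ 2))) / 2)) *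
      ((Real.exp (-1) * r₀ ^ 2) ^ (M₀ * M₁) * (Real.exp (-1) * r₂ ^ 2) ^ (M₁ * M₂))) ≤
    ∫⁻ h : CArray M₀ M₁, ∫⁻ g : CArray M₁ M₂, ENNReal.ofReal (1 / 4 * Real.exp
        (-(y * (∑ k, columnEnergy h k * rowEnergy g k) / 2)))
        ∂(gaussianArray M₁ M₂) ∂(gaussianArray M₀ M₁) := by
  set c := 1 / 4 * Real.exp (-(y * (M₁ * (M₀ * r₀ ^ 2 * (M₂ * r₂ ^ 2))) / 2)) with hc
  let s₀ : Set (CArray M₀ M₁) := {h | ∀ i j, ‖h i j‖ < r₀}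
  let s₂ : Set (CArray M₁ M₂) := {g | ∀ i j, ‖g i j‖ < r₂}
  have hs₀ : MeasurableSet s₀ := by
    simp only [s₀, measurableSet_setOfPred]
    fun_prop
  have hs₂ : MeasurableSet s₂ := by
    simp only [s₂, measurableSet_setOfPred]
    fun_prop
  calc _ = ENNReal.ofReal c * (ENNReal.ofReal ((Real.exp (-1) * r₂ ^ 2) ^ (M₁ * M₂)) *
        ENNReal.ofReal ((Real.exp (-1) * r₀ ^ 2) ^ (M₀ * M₁))) := by
        rw [← ENNReal.ofReal_mul (by positivity), ← ENNReal.ofReal_mul (by positivity)]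
        congr 1
        ring
    _ ≤ ENNReal.ofReal c * (gaussianArray M₁ M₂ s₂ * gaussianArray M₀ M₁ s₀) := by
        gcongr
        · exact gaussianArray_ball_ge h₂ h₂'
        · exact gaussianArray_ball_ge h₀ h₀'
    _ = ∫⁻ h : CArray M₀ M₁ in s₀, ∫⁻ g : CArray M₁ M₂ in s₂, ENNReal.ofReal c
        ∂(gaussianArray M₁ M₂) ∂(gaussianArray M₀ M₁) := by
        simp only [setLIntegral_const, mul_assoc]
    _ ≤ ∫⁻ h : CArray M₀ M₁ in s₀, ∫⁻ g : CArray M₁ M₂ in s₂, ENNReal.ofReal (1 / 4 * Real.exp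
        (-(y * (∑ k, columnEnergy h k * rowEnergy g k) / 2)))
        ∂(gaussianArray M₁ M₂) ∂(gaussianArray M₀ M₁) := by
        refine setLIntegral_mono' hs₀ fun h hh => setLIntegral_mono' hs₂ fun g hg => ?_
        refine ENNReal.ofReal_le_ofReal ?_
        rw [hc]
        gcongr
        calc ∑ k, columnEnergy h k * rowEnergy g k
            ≤ ∑ _k : Fin M₁, M₀ * r₀ ^ 2 * (M₂ * r₂ ^ 2) := by
              refine Finset.sum_le_sum fun k _ => mul_le_mul
                (vecInner_self_le fun m => hh m k) (vecInner_self_le fun i => hg k i)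
                (rowEnergy_nonneg g k) (by positivity)
          _ = _ := by simp
    _ ≤ _ := (setLIntegral_le_lintegral _ _).trans
        (lintegral_mono fun h => setLIntegral_le_lintegral _ _)

namespace COSTBC

variable {M₀ M₁ M₂ L : ℕ} (c : COSTBC M₀ M₁ L)

lemma relayGain_sq (hM₀ : 0 < M₀) (hM₁ : 0 < M₁) {E : ℝ} (hE : 0 < E) :
    c.relayGain (E / 2) (E / (2 * M₁)) ^ 2 = E / (E * M₀ + 2 * L) := by
  have : (0 : ℝ) < M₀ := by positivity
  have : (0 : ℝ) < M₁ := by positivity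
  rw [relayGain, Real.sq_sqrt (by positivity)]
  field_simp

lemma pairwiseErrorProb_upper (hM₀ : 0 < M₀) (hM₁ : 0 < M₁) (hM₂ : 0 < M₂) {s s' : Fin L → ℂ}
    (hs : s ≠ s') {a : ℝ} (ha : 0 < a) (ha₀ : a < M₀) (ha₂ : a < M₂) :
    ∃ C : ℝ, 0 < C ∧ ∀ E, 1 ≤ E →
      c.pairwiseErrorProb M₂ (E / 2) (E / (2 * M₁)) s s' ≤ C * E ^ (-(a * M₁)) := by
  obtain ⟨C, hC, hbound⟩ := lintegral_exp_neg_channel_le (M₁ := M₁) hM₀ hM₂ ha ha₀ ha₂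
  have hΔ : 0 < vecInner (s - s') (s - s') :=
    (vecInner_self_nonneg _).lt_of_ne fun h0 => hs (sub_eq_zero.1 (vecInner_self_eq_zero.1 h0.symm))
  set Δ := vecInner (s - s') (s - s')
  have hM₀' : (1 : ℝ) ≤ M₀ := by exact_mod_cast hM₀
  set κ := Δ / (8 * (M₀ + 2 * L)) with hκ
  have hκ0 : 0 < κ := by positivity
  refine ⟨C * κ ^ (-(a * M₁)), by positivity, fun E hE => ?_⟩
  have hE0 : 0 < E := by linarith
  rw [c.pairwiseErrorProb_eq]
  refine ENNReal.toReal_le_of_le_ofReal (by positivity) ?_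
  rw [mul_assoc, ← Real.mul_rpow hκ0.le hE0.le]
  refine le_trans (lintegral_mono fun h => lintegral_mono fun g => ?_)
    (hbound (κ * E) (by positivity))
  refine (c.conditional_error_bounds hM₀ (by positivity) s s' h g).1.trans
    (ENNReal.ofReal_le_ofReal ?_)
  rw [c.relayGain_sq hM₀ hM₁ hE0, Real.exp_le_exp, neg_le_neg_iff]
  set S := ∑ k, columnEnergy h k * rowEnergy g k
  have hS : 0 ≤ S := Finset.sum_nonneg fun k _ =>
    mul_nonneg (columnEnergy_nonneg h k) (rowEnergy_nonneg g k)
  have hG : 0 ≤ ∑ k, rowEnergy g k := Finset.sum_nonneg fun k _ => rowEnergy_nonneg g k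
  set G := ∑ k, rowEnergy g k
  set q := E / (E * M₀ + 2 * L) with hq
  have hq1 : q ≤ 1 := by
    rw [hq, div_le_one (by positivity)]
    nlinarith [(Nat.cast_nonneg L : (0 : ℝ) ≤ L)]
  have hq0 : 0 ≤ q := by positivity
  have hq2 : 1 / (M₀ + 2 * L) ≤ q := by
    rw [hq, div_le_div_iff₀ (by positivity) (by positivity)]
    nlinarith [(Nat.cast_nonneg L : (0 : ℝ) ≤ L)]
  calc κ * E * S / (1 + G) = (1 / (M₀ + 2 * L)) * Δ * (E / 2 * S) / (1 + G) / 4 := by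
        rw [hκ]; field_simp; ring
    _ ≤ q * Δ * (E / 2 * S) / (1 + q * G) / 4 := by
        gcongr
        exact mul_le_of_le_one_left hG hq1

lemma pairwiseErrorProb_lower (hM₀ : 0 < M₀) (hM₁ : 0 < M₁) (s s' : Fin L → ℂ) {E r₀ r₂ : ℝ}
    (hE : 1 ≤ E) (h₀ : 0 ≤ r₀) (h₀' : r₀ ≤ 1) (h₂ : 0 ≤ r₂) (h₂' : r₂ ≤ 1)
    (hr : E * (r₀ ^ 2 * r₂ ^ 2) = 1) :
    1 / 4 * Real.exp (-(vecInner (s - s') (s - s') * (M₀ * M₁ * M₂) / 2)) *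
      ((Real.exp (-1) * r₀ ^ 2) ^ (M₀ * M₁) * (Real.exp (-1) * r₂ ^ 2) ^ (M₁ * M₂)) ≤
    c.pairwiseErrorProb M₂ (E / 2) (E / (2 * M₁)) s s' := by
  have hE0 : 0 < E := by linarith
  have hM₀' : (1 : ℝ) ≤ M₀ := by exact_mod_cast hM₀
  have hΔ := vecInner_self_nonneg (s - s')
  set Δ := vecInner (s - s') (s - s')
  rw [c.pairwiseErrorProb_eq]
  have hfin : ∀ f : CArray M₀ M₁ → CArray M₁ M₂ → ENNReal, (∀ h g, f h g ≤ 1) →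
      ∫⁻ h, ∫⁻ g, f h g ∂(gaussianArray M₁ M₂) ∂(gaussianArray M₀ M₁) ≠ ⊤ := by
    intro f hf
    refine ne_top_of_le_ne_top ENNReal.one_ne_top ?_
    calc _ ≤ ∫⁻ _ : CArray M₀ M₁, ∫⁻ _ : CArray M₁ M₂, 1
          ∂(gaussianArray M₁ M₂) ∂(gaussianArray M₀ M₁) :=
          lintegral_mono fun h => lintegral_mono fun g => hf h g
      _ = 1 := by simp
  rw [← ENNReal.ofReal_le_iff_le_toReal (hfin _ fun h g => prob_le_one)]
  have h1 := le_lintegral_exp_neg_channel (M₀ := M₀) (M₁ := M₁) (M₂ := M₂) (y := Δ * E)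
    (by positivity) h₀ h₀' h₂ h₂'
  have e : Δ * E * (M₁ * (M₀ * r₀ ^ 2 * (M₂ * r₂ ^ 2))) = Δ * (M₀ * M₁ * M₂) := by
    calc _ = Δ * (M₀ * M₁ * M₂) * (E * (r₀ ^ 2 * r₂ ^ 2)) := by ring
      _ = _ := by rw [hr, mul_one]
  rw [e] at h1
  refine h1.trans (lintegral_mono fun h => lintegral_mono fun g => ?_)
  refine le_trans (ENNReal.ofReal_le_ofReal ?_)
    (c.conditional_error_bounds hM₀ (by positivity) s s' h g).2
  rw [c.relayGain_sq hM₀ hM₁ hE0]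
  set S := ∑ k, columnEnergy h k * rowEnergy g k
  have hS : 0 ≤ S := Finset.sum_nonneg fun k _ =>
    mul_nonneg (columnEnergy_nonneg h k) (rowEnergy_nonneg g k)
  set q := E / (E * M₀ + 2 * L) with hq
  have hq1 : q ≤ 1 := by
    rw [hq, div_le_one (by positivity)]
    nlinarith [(Nat.cast_nonneg L : (0 : ℝ) ≤ L)]
  have hq0 : 0 ≤ q := by positivity
  have hle : q * Δ * (E / 2 * S) ≤ Δ * E * S := by
    calc q * Δ * (E / 2 * S) ≤ 1 * Δ * (E * S) := by gcongr; linarith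
      _ = _ := by ring
  refine mul_le_mul_of_nonneg_left (Real.exp_le_exp.2 ?_) (by norm_num)
  linarith

end COSTBC

end

theorem theorem4 {M₀ M₁ M₂ L : ℕ} (hM₀ : 0 < M₀) (hM₁ : 0 < M₁) (hM₂ : 0 < M₂)
    (c : COSTBC M₀ M₁ L) :
    (∀ E : ℝ, 0 < E →
      c.sourcePower (E / 2) = E / 2 ∧
      (∀ k, c.relayPower (E / 2) (E / (2 * M₁)) k = E / (2 * M₁)) ∧
      c.sourcePower (E / 2) + ∑ k, c.relayPower (E / 2) (E / (2 * M₁)) k = E) ∧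
    ∀ s ∈ c.codebook, ∀ s' ∈ c.codebook, s ≠ s' →
      HasDiversityGain (fun E => c.pairwiseErrorProb M₂ (E / 2) (E / (2 * M₁)) s s')
        ((min (M₀ * M₁) (M₁ * M₂) : ℕ) : ℝ) := by
  have hM₁' : (0 : ℝ) < M₁ := by positivity
  refine ⟨fun E hE => ?_, fun s _ s' _ hs => ?_⟩
  · have h1 := c.sourcePower_eq hM₀ (by positivity : 0 ≤ E / 2)
    have h2 := fun k => c.relayPower_eq hM₀ hM₁ (by positivity : 0 < E / 2)
      (by positivity : 0 ≤ E / (2 * M₁)) k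
    refine ⟨h1, h2, ?_⟩
    simp only [h1, h2, Finset.sum_const, Finset.card_univ, Fintype.card_fin, nsmul_eq_mul]
    field_simp
    norm_num
  · refine hasDiversityGain_of_bounds ?_ ?_ fun b hb hbd => ?_
    · exact_mod_cast lt_min (Nat.mul_pos hM₀ hM₁) (Nat.mul_pos hM₁ hM₂)
    · refine ⟨1 / 4 * Real.exp (-(vecInner (s - s') (s - s') * (M₀ * M₁ * M₂) / 2)) *
        (Real.exp (-1) ^ (M₀ * M₁) * Real.exp (-1) ^ (M₁ * M₂)), by positivity, fun E hE => ?_⟩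
      have hE0 : 0 < E := by linarith
      -- the gains of the weaker hop are taken of order `E ^ (-1 / 2)`, those of the other of order `1`
      have hr0 : 0 ≤ (√E)⁻¹ := by positivity
      have hr1 : (√E)⁻¹ ≤ 1 := inv_le_one_of_one_le₀ (Real.one_le_sqrt.2 hE)
      have hr2 : (√E)⁻¹ ^ 2 = E⁻¹ := by rw [inv_pow, Real.sq_sqrt hE0.le]
      have hpow : ∀ n : ℕ, E ^ (-(n : ℝ)) = E⁻¹ ^ n := by
        intro n
        rw [Real.rpow_neg hE0.le, Real.rpow_natCast, inv_pow]
      rw [hpow]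
      rcases le_total (M₀ * M₁) (M₁ * M₂) with hle | hle
      · rw [min_eq_left hle]
        refine le_trans (le_of_eq ?_) (c.pairwiseErrorProb_lower (M₂ := M₂) hM₀ hM₁ s s' hE hr0 hr1
          zero_le_one le_rfl (by rw [hr2]; field_simp))
        rw [hr2, mul_pow]
        ring
      · rw [min_eq_right hle]
        refine le_trans (le_of_eq ?_) (c.pairwiseErrorProb_lower (M₂ := M₂) hM₀ hM₁ s s' hE
          zero_le_one le_rfl hr0 hr1 (by rw [hr2]; field_simp))
        rw [hr2, mul_pow _ E⁻¹]
        ring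
    · have hbd' : b < M₀ * M₁ ∧ b < M₁ * M₂ := by
        rw [Nat.cast_min, lt_min_iff] at hbd
        exact_mod_cast hbd
      obtain ⟨C, hC, h⟩ := c.pairwiseErrorProb_upper hM₀ hM₁ hM₂ hs
        (a := b / M₁) (by positivity) (by rw [div_lt_iff₀ hM₁']; exact hbd'.1)
        (by rw [div_lt_iff₀' hM₁']; exact hbd'.2)
      rw [div_mul_cancel₀ _ hM₁'.ne'] at h
      exact ⟨C, hC, h⟩
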